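/- **Alternative Characterization of Adjoints.** Let $\mathbb{E}$ be a field of characteristic zero, let $X$ be a separated integral scheme of finite type over $\mathbb{E}$, of dimension $l$ and with function field $K$, and let $m \ge 0$ be an integer. Let $\Omega^m_{X,rat} := (\bigwedge^l \Omega_{K|\mathbb{E}})^{\otimes m}$ be the $K$-vector space of rational $m$-fold $l$-forms. A *formal prime divisor* on $X$ is given by a discrete valuation ring $A$ with $\mathbb{E} \subset A$ and field of fractions $K$, whose residue field has transcendence degree $l-1$ over $\mathbb{E}$, such that, $\widehat A$ being the completion of $A$ at its maximal ideal and $Q(\widehat A)$ its field of fractions, the rational map $\operatorname{Spec} \widehat A \dashrightarrow X$ given by $K \subset Q(\widehat A)$ is a morphism $\varphi : \operatorname{Spec} \widehat A \to X$. Its *center* is the image of the closed point under $\varphi$. A form $\eta \in \Omega^m_{X,rat}$ is *regular at* $\varphi$ if $1 \otimes \eta \in Q(\widehat A) \otimes_K \Omega^m_{X,rat}$ lies in the image of $\widehat A \otimes_A (\bigwedge^l \Omega_{A|\mathbb{E}})^{\otimes m}$. The *sheaf of $m$-adjoint forms* $\Omega^m_{X,adj}$ is the sheaf of $\mathcal{O}_X$-modules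 whose sections over a nonempty open set $U \subseteq X$ are the $\eta \in \Omega^m_{X,rat}$ that are regular at all formal prime divisors on $X$ with center in $U$. Let $\pi : Y \to X$ be a desingularization, that is, a proper birational morphism over $\mathbb{E}$ from a regular integral scheme $Y$, and let $\omega_Y := \bigwedge^l \Omega_{Y|\mathbb{E}}$. Then $$\Omega^m_{X,adj} \cong \pi_*(\omega_Y^{\otimes m})$$ as $\mathcal{O}_X$-modules. In particular, $\pi_*(\omega_Y^{\otimes m})$ does not depend, up to isomorphism, on the choice of the desingularization: if $\pi' : Y' \to X$ is another one, then $\pi_*(\omega_Y^{\otimes m}) \cong \pi'_*(\omega_{Y'}^{\otimes m})$. -/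

import Mathlib

open CategoryTheory AlgebraicGeometry TopologicalSpace Opposite
open scoped TensorProduct

universe u

noncomputable section

/-! ### Pluri-differential forms of an algebra -/

/-- The module `(⋀^l Ω_{R/E})^{⊗ m}` of `m`-fold differential `l`-forms of an `E`-algebra `R`. -/
abbrev PluriForm (E R : Type u) [CommRing E] [CommRing R] [Algebra E R] (l m : ℕ) : Type u :=
  ⨂[R]^m (⋀[R]^l Ω[R⁄E])

namespace PluriForm

section Map

variable (E R S : Type u) [CommRing E] [CommRing R] [CommRing S] [Algebra E R] [Algebra E S]
  [Algebra R S] [IsScalarTower E R S] (l m : ℕ)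

/-- The map `⋀^l Ω_{R/E} → ⋀^l Ω_{S/E}` induced by a homomorphism `R → S` of `E`-algebras,
`da₁ ∧ ⋯ ∧ daₗ ↦ da₁ ∧ ⋯ ∧ daₗ`. -/
def wedgeMap : (⋀[R]^l Ω[R⁄E]) →ₗ[R] (⋀[S]^l Ω[S⁄E]) :=
  exteriorPower.alternatingMapLinearEquiv
    { toFun := fun v => exteriorPower.ιMulti S l (fun i => KaehlerDifferential.map E E R S (v i))
      map_update_add' := by
        intro _ v i x y
        have h : ∀ z, (fun j => KaehlerDifferential.map E E R S (Function.update v i z j)) =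
            Function.update (fun j => KaehlerDifferential.map E E R S (v j)) i
              (KaehlerDifferential.map E E R S z) := fun z => by
          funext j
          exact Function.apply_update (fun _ => KaehlerDifferential.map E E R S) v i z j
        simp only [h, map_add, AlternatingMap.map_update_add]
      map_update_smul' := by
        intro _ v i c x
        have h : ∀ z, (fun j => KaehlerDifferential.map E E R S (Function.update v i z j)) =
            Function.update (fun j => KaehlerDifferential.map E E R S (v j)) i
              (KaehlerDifferential.map E E R S z) := fun z => by
          funext j
          exact Function.apply_update (fun _ => KaehlerDifferential.map E E R S) v i z j
        simp only [h, map_smul]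
        rw [← algebraMap_smul S c (KaehlerDifferential.map E E R S x),
          AlternatingMap.map_update_smul, algebraMap_smul]
      map_eq_zero_of_eq' := by
        intro v i j h hij
        exact AlternatingMap.map_eq_zero_of_eq _ _ (by simp [h]) hij }

/-- The map `(⋀^l Ω_{R/E})^{⊗ m} → (⋀^l Ω_{S/E})^{⊗ m}` induced by a homomorphism `R → S` of
`E`-algebras. -/
def linearMap : PluriForm E R l m →ₗ[R] PluriForm E S l m :=
  PiTensorProduct.lift
    (((PiTensorProduct.tprod S).restrictScalars R).compLinearMap (fun _ => wedgeMap E R S l))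

@[simp]
lemma wedgeMap_ιMulti (v : Fin l → Ω[R⁄E]) :
    wedgeMap E R S l (exteriorPower.ιMulti R l v) =
      exteriorPower.ιMulti S l (fun i => KaehlerDifferential.map E E R S (v i)) := by
  simp [wedgeMap]

@[simp]
lemma linearMap_tprod (v : Fin m → ⋀[R]^l Ω[R⁄E]) :
    linearMap E R S l m (PiTensorProduct.tprod R v) =
      PiTensorProduct.tprod S (fun i => wedgeMap E R S l (v i)) := by
  simp [linearMap]

lemma map_self (x : Ω[R⁄E]) : KaehlerDifferential.map E E R R x = x := by
  have h : KaehlerDifferential.map E E R R = LinearMap.id := by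
    apply Derivation.liftKaehlerDifferential_unique
    ext a
    simp
  rw [h]; rfl

lemma wedgeMap_self (x : ⋀[R]^l Ω[R⁄E]) : wedgeMap E R R l x = x := by
  have h : wedgeMap E R R l = LinearMap.id := by
    apply exteriorPower.linearMap_ext
    ext v
    simp [map_self]
  rw [h]; rfl

lemma linearMap_self (x : PluriForm E R l m) : linearMap E R R l m x = x := by
  have h : linearMap E R R l m = LinearMap.id := by
    apply PiTensorProduct.ext
    ext v
    simp [wedgeMap_self]
  rw [h]; rfl

variable (T : Type u) [CommRing T] [Algebra E T] [Algebra R T] [Algebra S T]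
  [IsScalarTower E R T] [IsScalarTower E S T] [IsScalarTower R S T]

lemma map_map (x : Ω[R⁄E]) :
    KaehlerDifferential.map E E S T (KaehlerDifferential.map E E R S x) =
      KaehlerDifferential.map E E R T x := by
  have h : ((KaehlerDifferential.map E E S T).restrictScalars R).comp
      (KaehlerDifferential.map E E R S) = KaehlerDifferential.map E E R T := by
    apply Derivation.liftKaehlerDifferential_unique
    ext a
    simp [← IsScalarTower.algebraMap_apply]
  exact LinearMap.congr_fun h x

lemma wedgeMap_wedgeMap (x : ⋀[R]^l Ω[R⁄E]) :
    wedgeMap E S T l (wedgeMap E R S l x) = wedgeMap E R T l x := by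
  have h : ((wedgeMap E S T l).restrictScalars R).comp (wedgeMap E R S l) =
      wedgeMap E R T l := by
    apply exteriorPower.linearMap_ext
    ext v
    simp [map_map]
  exact LinearMap.congr_fun h x

lemma linearMap_linearMap (x : PluriForm E R l m) :
    linearMap E S T l m (linearMap E R S l m x) = linearMap E R T l m x := by
  have h : ((linearMap E S T l m).restrictScalars R).comp (linearMap E R S l m) =
      linearMap E R T l m := by
    apply PiTensorProduct.ext
    ext v
    simp [wedgeMap_wedgeMap]
  exact LinearMap.congr_fun h x

end Map

end PluriForm

/-! ### Completed divisorial valuation rings -/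

namespace ValuationSubring

variable {K : Type u} [Field K] (A : ValuationSubring K)

/-- The completion `Â` of a valuation ring `A` with respect to its maximal ideal. -/
abbrev Completed : Type u := AdicCompletion (IsLocalRing.maximalIdeal A) A

/-- The total ring of fractions `Q(Â)` of the completion. -/
abbrev CompletedFrac : Type u := FractionRing A.Completed

variable [IsDiscreteValuationRing A]

lemma isUnit_algebraMap_completedFrac (a : nonZeroDivisors A) :
    IsUnit (((algebraMap A.Completed A.CompletedFrac).comp
      (algebraMap A A.Completed)) (a : A)) := by
  have h : IsSMulRegular A.Completed (algebraMap A A.Completed a) :=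
    IsSMulRegular.of_flat (isRegular_iff_mem_nonZeroDivisors.mpr a.2).left
  exact IsLocalization.map_units A.CompletedFrac
    (⟨algebraMap A A.Completed a, isRegular_iff_mem_nonZeroDivisors.mp
      (Commute.isRegular_iff (Commute.all _)|>.mpr h)⟩ : nonZeroDivisors A.Completed)

/-- The embedding `K → Q(Â)` extending `A → Â`. -/
def fracMap : K →+* A.CompletedFrac :=
  IsLocalization.lift (M := nonZeroDivisors A) A.isUnit_algebraMap_completedFrac

instance : Algebra K A.CompletedFrac := A.fracMap.toAlgebra

end ValuationSubring

/-- A divisorial valuation ring of an extension `K` of `E` of transcendence degree `l`: a discrete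
valuation ring `A` of rank one with field of fractions `K` that contains `E` and whose residue
field has transcendence degree `l - 1` over `E`. -/
structure DivisorialValuationRing (E K : Type u) [Field E] [Field K] [Algebra E K] (l : ℕ) where
  /-- the valuation ring -/
  ring : ValuationSubring K
  algebraMap_mem : ∀ e : E, algebraMap E K e ∈ ring
  isDiscrete : IsDiscreteValuationRing ring
  trdeg_residueField :
    letI : Algebra E ring := ((algebraMap E K).codRestrict ring.toSubring algebraMap_mem).toAlgebra
    Algebra.trdeg E (IsLocalRing.ResidueField ring) + 1 = l

namespace DivisorialValuationRing

variable {E K : Type u} [Field E] [Field K] [Algebra E K] {l : ℕ}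
  (A : DivisorialValuationRing E K l)

instance : IsDiscreteValuationRing A.ring := A.isDiscrete

instance : Algebra E A.ring :=
  ((algebraMap E K).codRestrict A.ring.toSubring A.algebraMap_mem).toAlgebra

instance : IsScalarTower E A.ring K := IsScalarTower.of_algebraMap_eq' rfl

/-- The image of `Â ⊗_A (⋀^l Ω_{A/E})^{⊗ m}` in `Q(Â) ⊗_K (⋀^l Ω_{K/E})^{⊗ m}`, that is, the
`Â`-submodule generated by the forms of `A`. -/
def completedForms (m : ℕ) :
    Submodule A.ring.Completed (A.ring.CompletedFrac ⊗[K] PluriForm E K l m) :=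
  Submodule.span A.ring.Completed
    (Set.range fun w : PluriForm E A.ring l m =>
      (1 : A.ring.CompletedFrac) ⊗ₜ[K] PluriForm.linearMap E A.ring K l m w)

end DivisorialValuationRing

/-! ### Formal prime divisors and adjoint forms -/

namespace AlgebraicGeometry.Scheme

section BaseField

variable (E : Type u) [Field E] (X : Scheme.{u}) [X.Over (Spec (.of E))]

/-- The ring homomorphism `E → Γ(X, U)` given by the structure morphism `X ⟶ Spec E`. -/
def baseHom (U : X.Opens) : E →+* Γ(X, U) :=
  ((Scheme.ΓSpecIso (.of E)).inv ≫ (X ↘ Spec (.of E)).appTop ≫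
    X.presheaf.map (homOfLE le_top).op).hom

instance (U : X.Opens) : Algebra E Γ(X, U) := (X.baseHom E U).toAlgebra

instance [IrreducibleSpace X] : Algebra E X.functionField :=
  ((X.presheaf.germ ⊤ (genericPoint X) trivial).hom.comp (X.baseHom E ⊤)).toAlgebra

end BaseField

section Canonical

variable (E : Type u) [Field E] (X : Scheme.{u}) [X.Over (Spec (.of E))] (l m : ℕ)

instance (U : X.Opensᵒᵖ) : Module (X.ringCatSheaf.obj.obj U) (PluriForm E Γ(X, U.unop) l m) :=
  inferInstanceAs (Module Γ(X, U.unop) (PluriForm E Γ(X, U.unop) l m))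

lemma map_baseHom {V U : X.Opens} (i : U ⟶ V) (e : E) :
    X.presheaf.map i.op (X.baseHom E V e) = X.baseHom E U e := by
  simp only [baseHom, CommRingCat.hom_comp, RingHom.comp_apply]
  rw [← CommRingCat.comp_apply, ← Functor.map_comp]
  rfl

/-- Restriction of forms from `V` to `U ⊆ V`. -/
def restrictForms {V U : X.Opens} (i : U ⟶ V) :
    PluriForm E Γ(X, V) l m →+ PluriForm E Γ(X, U) l m :=
  letI : Algebra Γ(X, V) Γ(X, U) := (X.presheaf.map i.op).hom.toAlgebra
  haveI : IsScalarTower E Γ(X, V) Γ(X, U) :=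
    IsScalarTower.of_algebraMap_eq fun e => (map_baseHom E X i e).symm
  (PluriForm.linearMap E Γ(X, V) Γ(X, U) l m).toAddMonoidHom

lemma restrictForms_id (U : X.Opens) (x : PluriForm E Γ(X, U) l m) :
    restrictForms E X l m (𝟙 U) x = x := by
  have key : ∀ (a : Algebra Γ(X, U) Γ(X, U)) (_ : a = Algebra.id _)
      (t : @IsScalarTower E Γ(X, U) Γ(X, U) _ a.toSMul _),
      @PluriForm.linearMap E Γ(X, U) Γ(X, U) _ _ _ _ _ a t l m x = x := by
    rintro _ rfl _
    exact PluriForm.linearMap_self E Γ(X, U) l m x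
  refine key _ ?_ _
  ext a b
  change X.presheaf.map (𝟙 _) a * b = a * b
  simp

lemma restrictForms_comp {U V W : X.Opens} (i : U ⟶ V) (j : V ⟶ W) (x : PluriForm E Γ(X, W) l m) :
    restrictForms E X l m (i ≫ j) x = restrictForms E X l m i (restrictForms E X l m j x) := by
  let : Algebra Γ(X, W) Γ(X, V) := (X.presheaf.map j.op).hom.toAlgebra
  let : Algebra Γ(X, V) Γ(X, U) := (X.presheaf.map i.op).hom.toAlgebra
  let : Algebra Γ(X, W) Γ(X, U) := (X.presheaf.map (i ≫ j).op).hom.toAlgebra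
  have : IsScalarTower E Γ(X, W) Γ(X, V) :=
    IsScalarTower.of_algebraMap_eq fun e => (map_baseHom E X j e).symm
  have : IsScalarTower E Γ(X, V) Γ(X, U) :=
    IsScalarTower.of_algebraMap_eq fun e => (map_baseHom E X i e).symm
  have : IsScalarTower E Γ(X, W) Γ(X, U) :=
    IsScalarTower.of_algebraMap_eq fun e => (map_baseHom E X (i ≫ j) e).symm
  have : IsScalarTower Γ(X, W) Γ(X, V) Γ(X, U) :=
    IsScalarTower.of_algebraMap_eq fun a => by
      change X.presheaf.map (i ≫ j).op a = X.presheaf.map i.op (X.presheaf.map j.op a)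
      simp
  exact (PluriForm.linearMap_linearMap E Γ(X, W) Γ(X, V) l m Γ(X, U) x).symm

lemma restrictForms_smul {U V : X.Opens} (i : U ⟶ V) (a : Γ(X, V)) (x : PluriForm E Γ(X, V) l m) :
    restrictForms E X l m i (a • x) = X.presheaf.map i.op a • restrictForms E X l m i x := by
  let : Algebra Γ(X, V) Γ(X, U) := (X.presheaf.map i.op).hom.toAlgebra
  have : IsScalarTower E Γ(X, V) Γ(X, U) :=
    IsScalarTower.of_algebraMap_eq fun e => (map_baseHom E X i e).symm
  change PluriForm.linearMap E Γ(X, V) Γ(X, U) l m (a • x) = _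
  rw [map_smul, ← algebraMap_smul Γ(X, U) a]
  rfl

/-- The presheaf `U ↦ (⋀^l Ω_{Γ(X, U)/E})^{⊗ m}` of abelian groups. -/
def formsAbPresheaf : X.Opensᵒᵖ ⥤ Ab.{u} where
  obj U := .of (PluriForm E Γ(X, U.unop) l m)
  map i := AddCommGrpCat.ofHom (restrictForms E X l m i.unop)
  map_id U := by
    ext x
    exact restrictForms_id E X l m U.unop x
  map_comp i j := by
    ext x
    exact restrictForms_comp E X l m j.unop i.unop x

instance (U : X.Opensᵒᵖ) :
    Module (X.ringCatSheaf.obj.obj U) ((formsAbPresheaf E X l m).obj U) :=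
  inferInstanceAs (Module Γ(X, U.unop) (PluriForm E Γ(X, U.unop) l m))

/-- The presheaf of modules `U ↦ (⋀^l Ω_{Γ(X, U)/E})^{⊗ m}`. -/
def formsPresheaf : X.PresheafOfModules :=
  PresheafOfModules.ofPresheaf (formsAbPresheaf E X l m)
    (fun _ _ i a x => restrictForms_smul E X l m i.unop a x)

/-- The sheaf of modules `(⋀^l Ω_{X/E})^{⊗ m}`, that is, the sheaf associated to the presheaf
`U ↦ (⋀^l Ω_{Γ(X, U)/E})^{⊗ m}` (differentials, exterior powers and tensor powers of sheaves are
the sheafifications of those of presheaves, and sheafifying once at the end gives the same). If `X`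
is regular of dimension `l`, then `ω_X = ⋀^l Ω_{X/E}` and this is `ω_X^{⊗ m}`. -/
def formsSheaf : X.Modules :=
  (PresheafOfModules.sheafification (𝟙 X.ringCatSheaf.obj)).obj (formsPresheaf E X l m)

end Canonical

section Adjoint

variable (E : Type u) [Field E] (X : Scheme.{u}) [X.Over (Spec (.of E))] [IsIntegral X]
  (l m : ℕ)

/-- The rational `m`-fold differential `l`-forms on `X`. -/
abbrev RationalForm : Type u := PluriForm E X.functionField l m

/-- A formal prime divisor on `X`: a divisorial valuation ring `A` of the function field `K` of `X`
such that the rational map `Spec Â ⇢ X` given by `K ⊆ Q(Â)` is a morphism. -/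
structure FormalPrimeDivisor extends DivisorialValuationRing E X.functionField l where
  /-- the morphism `Spec Â ⟶ X` -/
  hom : Spec (.of ring.Completed) ⟶ X
  /-- On `Spec Q(Â)` the morphism is the one given by the generic point of `X` and `K → Q(Â)`. -/
  fac : Spec.map (CommRingCat.ofHom (algebraMap ring.Completed ring.CompletedFrac)) ≫ hom =
    Spec.map (CommRingCat.ofHom (algebraMap X.functionField ring.CompletedFrac)) ≫
      X.fromSpecStalk (genericPoint X)

namespace FormalPrimeDivisor

variable {E X l m} (φ : FormalPrimeDivisor E X l)

/-- The center of a formal prime divisor is the image of the closed point. -/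
def center : X := φ.hom (IsLocalRing.closedPoint φ.ring.Completed)

/-- A rational form `η` is regular at the formal prime divisor `φ : Spec Â ⟶ X` if its image
`1 ⊗ η` over `Q(Â)` is a form over `Â`. -/
def IsRegular (η : RationalForm E X l m) : Prop :=
  (1 : φ.ring.CompletedFrac) ⊗ₜ[X.functionField] η ∈ φ.completedForms m

lemma isRegular_zero : φ.IsRegular (0 : RationalForm E X l m) := by
  simp [IsRegular]

lemma IsRegular.add {η θ : RationalForm E X l m} (hη : φ.IsRegular η) (hθ : φ.IsRegular θ) :
    φ.IsRegular (η + θ) := by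
  simpa [IsRegular, TensorProduct.tmul_add] using add_mem hη hθ

lemma IsRegular.neg {η : RationalForm E X l m} (hη : φ.IsRegular η) : φ.IsRegular (-η) := by
  have h : (1 : φ.ring.CompletedFrac) ⊗ₜ[X.functionField] (-η) = -(1 ⊗ₜ[X.functionField] η) :=
    eq_neg_of_add_eq_zero_left (by rw [← TensorProduct.tmul_add, neg_add_cancel,
      TensorProduct.tmul_zero])
  rw [IsRegular, h]
  exact neg_mem hη

/-- A section of the structure sheaf near the center lies in `Â`. -/
lemma exists_algebraMap_eq {U : X.Opens} (hφ : φ.center ∈ U) (hU : genericPoint X ∈ U)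
    (f : Γ(X, U)) : ∃ a : φ.ring.Completed, algebraMap φ.ring.Completed φ.ring.CompletedFrac a =
      algebraMap X.functionField φ.ring.CompletedFrac (X.presheaf.germ U _ hU f) := by
  have hsp : genericPoint X ⤳ φ.hom (IsLocalRing.closedPoint φ.ring.Completed) :=
    genericPoint_specializes _
  have h := φ.fac
  rw [← Scheme.Spec_stalkClosedPointTo_fromSpecStalk φ.hom,
    ← Scheme.SpecMap_stalkSpecializes_fromSpecStalk hsp, ← Category.assoc, ← Category.assoc,
    cancel_mono, ← Spec.map_comp, ← Spec.map_comp] at h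
  have h2 := Spec.map_injective h
  refine ⟨Scheme.stalkClosedPointTo φ.hom (X.presheaf.germ U _ hφ f), ?_⟩
  have h3 := congr(($h2).hom (X.presheaf.germ U _ hφ f))
  simp only [CommRingCat.hom_comp] at h3
  refine h3.trans ?_
  change algebraMap X.functionField φ.ring.CompletedFrac
    (X.presheaf.stalkSpecializes hsp (X.presheaf.germ U _ hφ f)) = _
  exact congrArg _ (TopCat.Presheaf.germ_stalkSpecializes_apply X.presheaf hφ hsp f)

lemma IsRegular.smul {U : X.Opens} (hφ : φ.center ∈ U) (hU : genericPoint X ∈ U) (f : Γ(X, U))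
    {η : RationalForm E X l m} (hη : φ.IsRegular η) :
    φ.IsRegular (X.presheaf.germ U _ hU f • η) := by
  obtain ⟨a, ha⟩ := φ.exists_algebraMap_eq hφ hU f
  have h := Submodule.smul_mem _ a hη
  rw [TensorProduct.smul_tmul', Algebra.smul_def, ha, ← Algebra.smul_def,
    TensorProduct.smul_tmul] at h
  exact h

end FormalPrimeDivisor

variable {X} in
lemma genericPoint_mem {U : X.Opens} (x : U) : genericPoint X ∈ U :=
  ((genericPoint_spec X).mem_open_set_iff U.isOpen).mpr ⟨x.1, trivial, x.2⟩

/-- The sections over `U` of the sheaf of `m`-adjoint forms: the constant functions on `U` whose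
value is a rational form that is regular at all formal prime divisors centered in `U`. (So a
section over a nonempty `U` is such a rational form, and over the empty set only `0` is left.) -/
def adjointSections (U : X.Opens) : AddSubgroup (U → RationalForm E X l m) where
  carrier := {s | ∃ η : RationalForm E X l m, (∀ x, s x = η) ∧
    ∀ φ : FormalPrimeDivisor E X l, φ.center ∈ U → φ.IsRegular η}
  zero_mem' := ⟨0, fun _ => rfl, fun φ _ => φ.isRegular_zero⟩
  add_mem' := by
    rintro s t ⟨η, hs, hη⟩ ⟨θ, ht, hθ⟩
    exact ⟨η + θ, fun x => by simp [hs, ht], fun φ h => (hη φ h).add φ (hθ φ h)⟩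
  neg_mem' := by
    rintro s ⟨η, hs, hη⟩
    exact ⟨-η, fun x => by simp [hs], fun φ h => (hη φ h).neg φ⟩

instance (U : X.Opens) : Module Γ(X, U) (adjointSections E X l m U) where
  smul f s := ⟨fun x => X.presheaf.germ U _ (genericPoint_mem x) f • s.1 x, by
    obtain ⟨η, hs, hη⟩ := s.2
    by_cases hU : genericPoint X ∈ U
    · exact ⟨X.presheaf.germ U _ hU f • η, fun x => by simp only [hs],
        fun φ h => (hη φ h).smul φ h hU f⟩
    · exact ⟨0, fun x => (hU (genericPoint_mem x)).elim, fun φ _ => φ.isRegular_zero⟩⟩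
  one_smul s := Subtype.ext <| funext fun x => by
    change X.presheaf.germ U _ (genericPoint_mem x) 1 • s.1 x = s.1 x
    rw [map_one, one_smul]
  mul_smul f g s := Subtype.ext <| funext fun x => by
    change X.presheaf.germ U _ (genericPoint_mem x) (f * g) • s.1 x =
      X.presheaf.germ U _ (genericPoint_mem x) f • X.presheaf.germ U _ (genericPoint_mem x) g • s.1 x
    rw [map_mul, mul_smul]
  smul_zero f := Subtype.ext <| funext fun x => smul_zero _
  smul_add f s t := Subtype.ext <| funext fun x => smul_add _ _ _
  add_smul f g s := Subtype.ext <| funext fun x => by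
    change X.presheaf.germ U _ (genericPoint_mem x) (f + g) • s.1 x =
      X.presheaf.germ U _ (genericPoint_mem x) f • s.1 x +
        X.presheaf.germ U _ (genericPoint_mem x) g • s.1 x
    rw [map_add, add_smul]
  zero_smul s := Subtype.ext <| funext fun x => by
    change X.presheaf.germ U _ (genericPoint_mem x) 0 • s.1 x = 0
    rw [map_zero, zero_smul]

/-- Restriction of adjoint forms from `V` to `U ⊆ V`. -/
def restrictAdjoint {V U : X.Opens} (i : U ⟶ V) :
    adjointSections E X l m V →+ adjointSections E X l m U where
  toFun s := ⟨fun x => s.1 ⟨x.1, i.le x.2⟩, by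
    obtain ⟨η, hs, hη⟩ := s.2
    exact ⟨η, fun x => hs _, fun φ h => hη φ (i.le h)⟩⟩
  map_zero' := rfl
  map_add' _ _ := rfl

/-- The presheaf of abelian groups of `m`-adjoint forms. -/
def adjointAbPresheaf : X.Opensᵒᵖ ⥤ Ab.{u} where
  obj U := .of (adjointSections E X l m U.unop)
  map i := AddCommGrpCat.ofHom (restrictAdjoint E X l m i.unop)

instance (U : X.Opensᵒᵖ) :
    Module (X.ringCatSheaf.obj.obj U) ((adjointAbPresheaf E X l m).obj U) :=
  inferInstanceAs (Module Γ(X, U.unop) (adjointSections E X l m U.unop))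

lemma restrictAdjoint_smul {U V : X.Opens} (i : U ⟶ V) (f : Γ(X, V))
    (s : adjointSections E X l m V) :
    restrictAdjoint E X l m i (f • s) = X.presheaf.map i.op f • restrictAdjoint E X l m i s :=
  Subtype.ext <| funext fun x => by
    change X.presheaf.germ V _ (genericPoint_mem ⟨x.1, i.le x.2⟩) f • s.1 ⟨x.1, i.le x.2⟩ =
      X.presheaf.germ U _ (genericPoint_mem x) (X.presheaf.map i.op f) • s.1 ⟨x.1, i.le x.2⟩
    rw [TopCat.Presheaf.germ_res_apply]

/-- The presheaf of modules of `m`-adjoint forms. -/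
def adjointPresheaf : X.PresheafOfModules :=
  PresheafOfModules.ofPresheaf (adjointAbPresheaf E X l m)
    (fun _ _ i f s => restrictAdjoint_smul E X l m i.unop f s)

lemma adjointAbPresheaf_isSheaf :
    TopCat.Presheaf.IsSheaf (X := X.toTopCat) (adjointAbPresheaf E X l m) := by
  refine (TopCat.Presheaf.isSheaf_iff_isSheafUniqueGluing _).mpr ?_
  intro ι (U : ι → X.Opens) (s : ∀ i, adjointSections E X l m (U i)) hs
  have hs' : ∀ (i j : ι) (x : X) (hi : x ∈ U i) (hj : x ∈ U j),
      (s i).1 ⟨x, hi⟩ = (s j).1 ⟨x, hj⟩ := fun i j x hi hj =>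
    congrFun (congrArg Subtype.val (hs i j)) ⟨x, hi, hj⟩
  choose η hη hreg using fun i => (s i).2
  choose k hk using fun x : ↑(iSup U) => Opens.mem_iSup.mp x.2
  have hη' : ∀ i j (_ : (U i : Set X).Nonempty) (_ : (U j : Set X).Nonempty), η i = η j := by
    rintro i j ⟨x, hx⟩ ⟨y, hy⟩
    have h := hs' i j _ (genericPoint_mem ⟨x, hx⟩) (genericPoint_mem ⟨y, hy⟩)
    rwa [hη, hη] at h
  let t : adjointSections E X l m (iSup U) := ⟨fun x => (s (k x)).1 ⟨x.1, hk x⟩, by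
    by_cases hne : Nonempty (iSup U : X.Opens)
    · obtain ⟨x₀⟩ := hne
      refine ⟨η (k x₀), fun x => ?_, fun φ hφ => ?_⟩
      · exact (hη _ _).trans (hη' _ _ ⟨x.1, hk x⟩ ⟨x₀.1, hk x₀⟩)
      · obtain ⟨i, hi⟩ := Opens.mem_iSup.mp hφ
        rw [hη' (k x₀) i ⟨x₀.1, hk x₀⟩ ⟨_, hi⟩]
        exact hreg i φ hi
    · exact ⟨0, fun x => (hne ⟨x⟩).elim, fun φ _ => φ.isRegular_zero⟩⟩
  refine ⟨t, fun i => Subtype.ext <| funext fun x => hs' _ _ _ _ _, fun t' ht' => ?_⟩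
  refine Subtype.ext <| funext fun x => ?_
  exact congrFun (congrArg Subtype.val (ht' (k x))) ⟨x.1, hk x⟩

/-- The sheaf of `m`-adjoint forms on `X`. -/
def adjointSheaf : X.Modules where
  val := adjointPresheaf E X l m
  isSheaf := adjointAbPresheaf_isSheaf E X l m

end Adjoint

/-- A desingularization of `X`: a proper birational morphism `π : Y ⟶ X` from a regular
scheme `Y`. -/
structure IsDesingularization {X Y : Scheme.{u}} (π : Y ⟶ X) : Prop where
  isProper : IsProper π
  /-- `π` restricts to an isomorphism of a dense open subscheme of `Y` with one of `X`. -/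
  birational : ∃ e : Y.PartialIso X, e.iso.hom ≫ e.target.ι = e.source.ι ≫ π
  regular : ∀ y : Y, IsRegularLocalRing (Y.presheaf.stalk y)

end AlgebraicGeometry.Scheme

end

/-! The completion in the definition of adjoint forms is harmless, adjoint forms are insensitive to
proper birational modifications, and on a regular scheme they are the ordinary forms.

Removing the completion. Since `Â ∩ K = A`, a formal prime divisor on `X` is the same as a
divisorial valuation ring `A` of `K` having a center on `X`. In characteristic zero `Ω_{K/E}` has
dimension `trdeg K = l`, so the rational forms make up a line over `K`, and the forms coming from
`A` are an `A`-submodule `I` of it. From `ÂI ∩ K = I` it follows that regularity at the divisor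
means lying in `I`. This is `forall_isRegular_iff`.

Birational invariance. For `π : Y ⟶ X` proper and birational the function fields agree, and by the
valuative criterion `A` has a center in `U` exactly when it has one in `π⁻¹ U`
(`hasCenterIn_comap_iff`). Thus the adjoint sheaf of `X` is the direct image of that of `Y`.

The regular case. At a point of `Y` with local ring `R` and residue field `k`, the conormal sequence
gives `dim (k ⊗ Ω_R) ≤ dim R + trdeg k ≤ l`. By Nakayama this many differentials generate `Ω_R`,
while the generic rank forces at least `l`. So near each point `Ω` is generated by `l` differentials
`da₁, …, daₗ`, and every rational form is `f · (da₁ ∧ ⋯ ∧ daₗ)^{⊗ m}` with a unique `f ∈ K`. The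
inequality above is now an equality, so the local ring `B_p` at a prime `p` of height one has a
residue field of transcendence degree `l - 1`: it is a divisorial valuation ring, and adjointness
gives `f ∈ B_p`. A regular noetherian domain is the intersection of these `B_p`, hence `f ∈ B`.
Conversely, a form on `U` is regular at every `A` with a center in `U`, because `A` contains the
sections over `U`. -/

noncomputable section

/-! ### Regular local rings -/

namespace IsRegularLocalRing

open IsLocalRing

variable {R : Type*} [CommRing R]

/-- An element outside `𝔪²` is a nonzero vector of `𝔪/𝔪²`. Complete it to a basis and lift: by
Nakayama the lifts generate `𝔪`, and modulo `x` one of these generators disappears. -/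
lemma exists_spanFinrank_maximalIdeal_quotient_add_one_le [IsLocalRing R] [IsNoetherianRing R]
    {x : R} (hx : x ∈ maximalIdeal R) (hx2 : x ∉ maximalIdeal R ^ 2)
    [IsLocalRing (R ⧸ Ideal.span {x})] :
    (maximalIdeal (R ⧸ Ideal.span {x})).spanFinrank + 1 ≤ (maximalIdeal R).spanFinrank := by
  set v : CotangentSpace R := (maximalIdeal R).toCotangent ⟨x, hx⟩ with hv
  have hv0 : v ≠ 0 := fun h => hx2 ((Ideal.toCotangent_eq_zero _ _).mp h)
  obtain ⟨W, hW⟩ := Submodule.exists_isCompl (Submodule.span (ResidueField R) {v})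
  let b := Module.finBasis (ResidueField R) W
  have hfr : Module.finrank (ResidueField R) W + 1 = (maximalIdeal R).spanFinrank := by
    rw [spanFinrank_maximalIdeal_eq_finrank_cotangentSpace,
      ← Submodule.finrank_add_eq_of_isCompl hW, finrank_span_singleton hv0, add_comm]
  choose y hy using fun i => (maximalIdeal R).toCotangent_surjective (b i : CotangentSpace R)
  have hspan : Submodule.span R (insert ⟨x, hx⟩ (Set.range y) : Set (maximalIdeal R)) = ⊤ := by
    rw [← CotangentSpace.span_image_eq_top_iff]
    rw [Set.image_insert_eq, ← Set.range_comp, Submodule.span_insert, eq_top_iff, ← hW.sup_eq_top]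
    refine sup_le_sup le_rfl ?_
    have : (maximalIdeal R).toCotangent ∘ y = W.subtype ∘ b := funext hy
    rw [this, Set.range_comp, ← Submodule.map_span, b.span_eq, Submodule.map_top,
      Submodule.range_subtype]
  have hm : maximalIdeal R = Ideal.span (insert x (Set.range fun i => (y i : R))) := by
    have := congrArg (Submodule.map (maximalIdeal R).subtype) hspan
    rw [Submodule.map_span, Submodule.map_top, Submodule.range_subtype, Set.image_insert_eq,
      ← Set.range_comp] at this
    exact this.symm
  have hm' : maximalIdeal (R ⧸ Ideal.span {x}) =
      Ideal.span (Set.range fun i => Ideal.Quotient.mk (Ideal.span {x}) (y i : R)) := by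
    have h1 : maximalIdeal (R ⧸ Ideal.span {x}) =
        (maximalIdeal R).map (Ideal.Quotient.mk (Ideal.span {x})) := by
      refine ((((isMaximal_iff _).mp ?_)).symm)
      have hle : Ideal.span {x} ≤ maximalIdeal R :=
        (Ideal.span_singleton_le_iff_mem _).mpr hx
      refine (Ideal.map_eq_top_or_isMaximal_of_surjective _ Ideal.Quotient.mk_surjective
        (maximalIdeal.isMaximal R)).resolve_left fun h => ?_
      have h2 := congrArg (Ideal.comap (Ideal.Quotient.mk (Ideal.span {x}))) h
      rw [Ideal.comap_map_of_surjective _ Ideal.Quotient.mk_surjective, ← RingHom.ker_eq_comap_bot,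
        Ideal.mk_ker, sup_eq_left.mpr hle, Ideal.comap_top] at h2
      exact (maximalIdeal.isMaximal R).ne_top h2
    refine (h1.trans (congrArg _ hm)).trans ?_
    rw [Ideal.map_span, Set.image_insert_eq, ← Set.range_comp, Ideal.span_insert]
    have : Ideal.Quotient.mk (Ideal.span {x}) x = 0 :=
      Ideal.Quotient.eq_zero_iff_mem.mpr (Ideal.mem_span_singleton_self x)
    rw [this]
    simp [Function.comp_def]
  rw [← hfr, hm']
  refine Nat.add_le_add_right ?_ 1
  refine (Submodule.spanFinrank_span_le_ncard_of_finite (Set.finite_range _)).trans ?_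
  exact (Finite.card_range_le _).trans (by simp)


lemma isLocalRing_quotient_span_singleton [IsLocalRing R] {x : R} (hx : x ∈ maximalIdeal R) :
    IsLocalRing (R ⧸ Ideal.span {x}) :=
  have : Nontrivial (R ⧸ Ideal.span {x}) := Ideal.Quotient.nontrivial_iff.mpr fun h =>
    (maximalIdeal.isMaximal R).ne_top (top_le_iff.mp (h.ge.trans
      ((Ideal.span_singleton_le_iff_mem _).mpr hx)))
  .of_surjective' _ Ideal.Quotient.mk_surjective

/-- Passing to the quotient lowers the embedding dimension by at least one and the Krull dimension
by at most one. -/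
lemma quotient_span_singleton [IsRegularLocalRing R] {x : R} (hx : x ∈ maximalIdeal R)
    (hx2 : x ∉ maximalIdeal R ^ 2) : IsRegularLocalRing (R ⧸ Ideal.span {x}) := by
  have := isLocalRing_quotient_span_singleton hx
  have h1 := exists_spanFinrank_maximalIdeal_quotient_add_one_le hx hx2
  refine .of_spanFinrank_maximalIdeal_le _ ?_
  have h2 := ringKrullDim_le_ringKrullDim_quotient_add_card (R := R) {x}
    (by simpa [ringJacobson_eq_maximalIdeal] using hx)
  rw [← IsRegularLocalRing.spanFinrank_maximalIdeal] at h2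
  rw [Finset.coe_singleton, Finset.card_singleton, Nat.cast_one] at h2
  have h3 : (((maximalIdeal (R ⧸ Ideal.span {x})).spanFinrank : ℕ) : WithBot ℕ∞) + 1 ≤
      ringKrullDim (R ⧸ Ideal.span {x}) + 1 := by
    refine le_trans ?_ h2
    exact_mod_cast h1
  exact ENat.WithBot.add_le_add_one_right_iff.mp h3

/-- A regular local ring is a domain. -/
theorem isDomain [IsRegularLocalRing R] : IsDomain R := by
  obtain ⟨d, hd⟩ : ∃ d, d = (maximalIdeal R).spanFinrank := ⟨_, rfl⟩
  induction d using Nat.strong_induction_on generalizing R with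
  | _ d ih =>
  by_cases hF : IsField R
  · exact hF.isDomain
  have hlt : maximalIdeal R ^ 2 < maximalIdeal R := (maximalIdeal_sq_lt_maximalIdeal R).mpr hF
  have hdim : ringKrullDim R ≠ 0 := by
    intro h0
    rw [← spanFinrank_maximalIdeal] at h0
    have h0 : (maximalIdeal R).spanFinrank = 0 := by exact_mod_cast h0
    rw [Submodule.spanFinrank_eq_zero_iff_eq_bot (maximalIdeal R).fg_of_isNoetherianRing] at h0
    exact hF (isField_iff_maximalIdeal_eq.mpr h0)
  have hfin := minimalPrimes.finite_of_isNoetherianRing R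
  obtain ⟨x, hx, hx'⟩ : ∃ x ∈ maximalIdeal R, x ∉ maximalIdeal R ^ 2 ∧
      ∀ p ∈ minimalPrimes R, x ∉ p := by
    by_contra! H
    -- Prime avoidance tolerates two ideals that are not prime; `𝔪²` is named in both places.
    have := (Ideal.subset_union_prime (s := insert (maximalIdeal R ^ 2) hfin.toFinset)
      (f := id) (maximalIdeal R ^ 2) (maximalIdeal R ^ 2) (I := maximalIdeal R) ?_).mp ?_
    · obtain ⟨p, hp, hle⟩ := this
      rcases Finset.mem_insert.mp hp with rfl | hp
      · exact hlt.not_ge hle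
      · have hp' := hfin.mem_toFinset.mp hp
        have := hp'.1.1
        have hpm : p = maximalIdeal R := le_antisymm (le_maximalIdeal this.ne_top) hle
        have h0 : p.height = 0 := Ideal.height_eq_zero_iff.mpr hp'
        rw [hpm] at h0
        exact hdim (by rw [← maximalIdeal_height_eq_ringKrullDim, h0]; rfl)
    · intro p hp h1 _
      exact (hfin.mem_toFinset.mp ((Finset.mem_insert.mp hp).resolve_left h1)).1.1
    · intro x hx
      by_cases hx2 : x ∈ maximalIdeal R ^ 2
      · exact Set.mem_biUnion (Finset.mem_coe.mpr (Finset.mem_insert_self _ _)) hx2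
      · obtain ⟨p, hp, hxp⟩ := H x hx hx2
        exact Set.mem_biUnion (Finset.mem_coe.mpr
          (Finset.mem_insert_of_mem (hfin.mem_toFinset.mpr hp))) hxp
  have := quotient_span_singleton hx hx'.1
  have hle := exists_spanFinrank_maximalIdeal_quotient_add_one_le hx hx'.1
  have hdom := ih _ (by omega) (R := R ⧸ Ideal.span {x}) rfl
  have hprime : (Ideal.span {x}).IsPrime := (Ideal.Quotient.isDomain_iff_prime _).mp hdom
  obtain ⟨p, hp, hpx⟩ := Ideal.exists_minimalPrimes_le (bot_le : ⊥ ≤ Ideal.span {x})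
  have hpp := hp.1.1
  -- The minimal prime `p` lies in `(x)` but does not contain `x`, so `p = x p`, and Nakayama gives
  -- `p = 0`.
  have hbot : p = ⊥ := by
    refine Submodule.eq_bot_of_le_smul_of_le_jacobson_bot (Ideal.span {x}) p
      p.fg_of_isNoetherianRing ?_ ?_
    · intro y hy
      obtain ⟨z, rfl⟩ := Ideal.mem_span_singleton'.mp (hpx hy)
      have hz : z ∈ p := (hpp.mem_or_mem hy).resolve_right (hx'.2 p hp)
      rw [mul_comm, ← smul_eq_mul]
      exact Submodule.smul_mem_smul (Ideal.mem_span_singleton_self x) hz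
    · rw [jacobson_eq_maximalIdeal ⊥ bot_ne_top]
      exact (Ideal.span_singleton_le_iff_mem _).mpr hx
  rw [hbot] at hpp
  exact IsDomain.of_bot_isPrime R

/-- In a regular local ring of dimension at least two the maximal ideal is not associated to a
nonzero principal ideal. -/
lemma maximalIdeal_isPrincipal_of_mul_mem [IsRegularLocalRing R] {f g : R} (hf : f ≠ 0)
    (hg : g ∉ Ideal.span {f}) (h : ∀ r ∈ maximalIdeal R, r * g ∈ Ideal.span {f}) :
    (maximalIdeal R).IsPrincipal := by
  have := isDomain (R := R)
  by_cases hF : IsField R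
  · rw [isField_iff_maximalIdeal_eq.mp hF]
    infer_instance
  obtain ⟨x, hx, hx2⟩ := SetLike.exists_of_lt ((maximalIdeal_sq_lt_maximalIdeal R).mpr hF)
  have := quotient_span_singleton hx hx2
  have hprime : (Ideal.span {x}).IsPrime :=
    (Ideal.Quotient.isDomain_iff_prime _).mp (isDomain (R := R ⧸ Ideal.span {x}))
  have hx0 : x ≠ 0 := fun h => hx2 (h ▸ zero_mem _)
  obtain ⟨y, hy⟩ := Ideal.mem_span_singleton'.mp (h x hx)
  have hyx : y ∉ Ideal.span {x} := by
    intro hyx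
    obtain ⟨z, rfl⟩ := Ideal.mem_span_singleton'.mp hyx
    refine hg (Ideal.mem_span_singleton'.mpr ⟨z, mul_left_cancel₀ hx0 ?_⟩)
    rw [← hy]; ring
  -- Put `x g = y f` and `r g = s f`. Cancelling `f` from `x s f = r y f` shows that the prime `x`
  -- divides `r y`; it does not divide `y`, hence it divides `r`.
  refine ⟨x, le_antisymm (fun r hr => ?_) ((Ideal.span_singleton_le_iff_mem _).mpr hx)⟩
  obtain ⟨s, hs⟩ := Ideal.mem_span_singleton'.mp (h r hr)
  refine (hprime.mem_or_mem (Ideal.mem_span_singleton'.mpr ⟨s, ?_⟩)).resolve_right hyx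
  refine mul_left_cancel₀ hf ?_
  linear_combination x * hs - r * hy

end IsRegularLocalRing

/-- A noetherian domain whose local rings are regular is the intersection of its localizations at
the primes of height one. -/
theorem IsFractionRing.exists_algebraMap_eq_of_height_eq_one {B K : Type*} [CommRing B] [IsDomain B]
    [IsNoetherianRing B] [Field K] [Algebra B K] [IsFractionRing B K]
    (hB : ∀ (p : Ideal B) [p.IsPrime], IsRegularLocalRing (Localization.AtPrime p)) (f : K)
    (hf : ∀ (p : Ideal B) [p.IsPrime], p.height = 1 →
      ∃ a b : B, b ∉ p ∧ f = algebraMap B K a / algebraMap B K b) :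
    ∃ a : B, algebraMap B K a = f := by
  obtain ⟨a, b, hb, rfl⟩ := IsFractionRing.div_surjective (A := B) f
  have hb0 : b ≠ 0 := nonZeroDivisors.ne_zero hb
  have hbK : algebraMap B K b ≠ 0 := by simpa using hb0
  by_cases hab : a ∈ Ideal.span {b}
  · obtain ⟨c, rfl⟩ := Ideal.mem_span_singleton'.mp hab
    exact ⟨c, by rw [map_mul, mul_div_cancel_right₀ _ hbK]⟩
  exfalso
  have hne : Ideal.Quotient.mk (Ideal.span {b}) a ≠ 0 :=
    fun h => hab (Ideal.Quotient.eq_zero_iff_mem.mp h)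
  -- The associated prime is taken in the submodule generated by the class of `a`, so that it is the
  -- annihilator of a multiple `c a` modulo `b`.
  obtain ⟨p, hp, -⟩ := exists_le_isAssociatedPrime_of_isNoetherianRing B
    (⟨_, Submodule.mem_span_singleton_self _⟩ :
      Submodule.span B {Ideal.Quotient.mk (Ideal.span {b}) a})
      (fun h => hne (congrArg Subtype.val h))
  obtain ⟨hp, y, hpy⟩ := isAssociatedPrime_iff.mp hp
  obtain ⟨c, hc⟩ := Submodule.mem_span_singleton.mp y.2
  have hmem (r : B) : r ∈ p ↔ r * (c * a) ∈ Ideal.span {b} := by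
    rw [hpy, Submodule.mem_colon_singleton, Submodule.mem_bot, ← Ideal.Quotient.eq_zero_iff_mem,
      ← Subtype.val_inj, Submodule.coe_smul, ← hc]
    simp [Algebra.smul_def]
  have := hB p
  have hbp : b ∈ p := (hmem b).mpr (Ideal.mul_mem_right _ _ (Ideal.mem_span_singleton_self b))
  have hprinc : (IsLocalRing.maximalIdeal (Localization.AtPrime p)).IsPrincipal := by
    refine IsRegularLocalRing.maximalIdeal_isPrincipal_of_mul_mem
      (f := algebraMap B _ b) (g := algebraMap B _ (c * a)) ?_ ?_ ?_
    · rwa [Ne, IsLocalization.to_map_eq_zero_iff _ p.primeCompl_le_nonZeroDivisors]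
    · intro h
      obtain ⟨z, hz⟩ := Ideal.mem_span_singleton'.mp h
      obtain ⟨⟨s, t⟩, hst⟩ := IsLocalization.surj p.primeCompl z
      have : algebraMap B (Localization.AtPrime p) (s * b) = algebraMap B _ (t * (c * a)) := by
        rw [map_mul, map_mul, ← hst, ← hz]; ring
      have := IsLocalization.injective _ p.primeCompl_le_nonZeroDivisors this
      exact t.2 ((hmem _).mpr (Ideal.mem_span_singleton'.mpr ⟨s, this⟩))
    · intro r hr
      obtain ⟨⟨s, t⟩, hst⟩ := IsLocalization.surj p.primeCompl r
      have hs : s ∈ p := by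
        rw [← IsLocalization.AtPrime.to_map_mem_maximal_iff (Localization.AtPrime p) p, ← hst]
        exact Ideal.mul_mem_right _ _ hr
      obtain ⟨z, hz⟩ := Ideal.mem_span_singleton'.mp ((hmem s).mp hs)
      have hu := IsLocalization.map_units (Localization.AtPrime p) t
      rw [← Ideal.mul_unit_mem_iff_mem _ hu]
      refine Ideal.mem_span_singleton'.mpr ⟨algebraMap B _ z, ?_⟩
      rw [← map_mul, hz, map_mul, ← hst]; ring
  -- Regularity turns a principal maximal ideal into dimension at most one, and `p` contains `b ≠
  -- 0`.
  have hht : p.height = 1 := by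
    refine le_antisymm ?_ ?_
    · obtain ⟨z, hz⟩ := hprinc
      have h1 := IsRegularLocalRing.spanFinrank_maximalIdeal (R := Localization.AtPrime p)
      rw [IsLocalization.AtPrime.ringKrullDim_eq_height p] at h1
      have h2 := Submodule.spanFinrank_span_le_ncard_of_finite
        (R := Localization.AtPrime p) (Set.finite_singleton z)
      rw [← hz, Set.ncard_singleton] at h2
      have h3 : (p.height : WithBot ℕ∞) ≤ ((1 : ℕ∞) : WithBot ℕ∞) := by
        rw [← h1]; exact_mod_cast h2
      exact_mod_cast h3
    · rw [Order.one_le_iff_ne_zero, Ne, Ideal.height_eq_zero_iff_eq_bot]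
      rintro rfl
      exact hb0 hbp
  obtain ⟨a', b', hb', h⟩ := hf p hht
  have hb'K : algebraMap B K b' ≠ 0 := by
    rw [Ne, FaithfulSMul.algebraMap_eq_zero_iff]
    exact fun h => hb' (h ▸ zero_mem p)
  rw [div_eq_div_iff hbK hb'K, ← map_mul, ← map_mul] at h
  have h := IsFractionRing.injective B K h
  -- From `a / b = a' / b'` it follows that `b'` kills the class of `c a` modulo `b`, contradicting
  -- `b' ∉ p`.
  refine hb' ((hmem b').mpr (Ideal.mem_span_singleton'.mpr ⟨c * a', ?_⟩))
  linear_combination -c * h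

/-! ### Dimension theory of algebras over a field -/

namespace Algebra

variable {E : Type u} [Field E]

/-- Lift a transcendence basis of `C` to `A` and adjoin a nonzero `z` in the kernel. If `z` were
algebraic over the lifts, it would satisfy a relation with nonzero constant term; `z` divides that
term, so the term dies in `C`, although `f` is injective on polynomials in the lifts. -/
lemma trdeg_add_one_le_of_surjective {A C : Type u} [CommRing A] [IsDomain A] [CommRing C]
    [IsDomain C] [Algebra E A] [Algebra E C] (f : A →ₐ[E] C) (hf : Function.Surjective f)
    (hf' : ¬ Function.Injective f) : trdeg E C + 1 ≤ trdeg E A := by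
  obtain ⟨ι, x, hx⟩ := exists_isTranscendenceBasis' (R := E) (A := C)
  rw [← hx.cardinalMk_eq_trdeg]
  choose y hy using fun i => hf (x i)
  have hfy : f ∘ y = x := funext hy
  have hyi : AlgebraicIndependent E y := .of_comp f (hfy ▸ hx.1)
  obtain ⟨z, hz, hz0⟩ : ∃ z, f z = 0 ∧ z ≠ 0 := by
    by_contra! H
    exact hf' ((injective_iff_map_eq_zero f).mpr H)
  have htr : Transcendental (adjoin E (Set.range y)) z := by
    intro halg
    obtain ⟨q, hq0, hq⟩ := halg.exists_nonzero_coeff_and_aeval_eq_zero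
      (mem_nonZeroDivisors_of_ne_zero hz0)
    obtain ⟨w, hw⟩ : ∃ w : A, (q.coeff 0 : A) = z * w := by
      have h1 := congrArg (Polynomial.aeval z) (Polynomial.divX_mul_X_add q)
      rw [hq, map_add, map_mul, Polynomial.aeval_X, Polynomial.aeval_C] at h1
      refine ⟨-Polynomial.aeval z q.divX, ?_⟩
      change algebraMap _ A (q.coeff 0) = _
      linear_combination h1
    obtain ⟨p, hp⟩ : ∃ p : MvPolynomial ι E, MvPolynomial.aeval y p = (q.coeff 0 : A) := by
      exact (Algebra.adjoin_range_eq_range_aeval E y).le (q.coeff 0).2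
    have hp0 : MvPolynomial.aeval x p = 0 := by
      have h2 : f (MvPolynomial.aeval y p) = 0 := by rw [hp, hw, map_mul, hz, zero_mul]
      rw [← hfy, ← h2]
      exact (MvPolynomial.comp_aeval_apply (φ := f) y p).symm
    have := (injective_iff_map_eq_zero _).mp hx.1 p hp0
    rw [this, map_zero] at hp
    exact hq0 (Subtype.ext hp.symm)
  have h := (hyi.option_iff_transcendental z).mpr htr
  simpa using h.cardinalMk_le_trdeg

/-- Each strict inclusion of primes costs at least one in the transcendence degree of the residue
domain. -/
lemma length_add_trdeg_quotient_le {B : Type u} [CommRing B] [Algebra E B]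
    (s : LTSeries (PrimeSpectrum B)) :
    (s.length : Cardinal) + trdeg E (B ⧸ s.last.asIdeal) ≤ trdeg E (B ⧸ s.head.asIdeal) := by
  induction s using RelSeries.inductionOn with
  | singleton q =>
    simp only [RelSeries.singleton_length, Nat.cast_zero, zero_add]
    rfl
  | cons l q lt ih =>
    have hlt : q.asIdeal < l.head.asIdeal := lt
    have h := trdeg_add_one_le_of_surjective (Ideal.Quotient.factorₐ E hlt.le)
      (Ideal.Quotient.factor_surjective hlt.le) fun hinj => by
        obtain ⟨z, hz, hzq⟩ := SetLike.exists_of_lt hlt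
        refine hzq (Ideal.Quotient.eq_zero_iff_mem.mp (hinj ?_))
        rw [map_zero]
        exact Ideal.Quotient.eq_zero_iff_mem.mpr hz
    simp only [RelSeries.cons_length, RelSeries.head_cons]
    rw [show (l.cons q lt).last = l.last from RelSeries.last_cons ..]
    refine le_trans ?_ h
    push_cast
    rw [add_right_comm]
    exact add_le_add_left ih 1

lemma height_add_trdeg_quotient_le {B : Type u} [CommRing B] [IsNoetherianRing B] [Algebra E B]
    (p : Ideal B) [p.IsPrime] {n : ℕ} (hn : p.height = n) :
    (n : Cardinal) + trdeg E (B ⧸ p) ≤ trdeg E B := by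
  obtain ⟨s, hs, hs'⟩ := p.exists_ltSeries_length_eq_height
  have hsn : s.length = n := by exact_mod_cast hs'.trans hn
  have h := length_add_trdeg_quotient_le (E := E) s
  rw [hsn, hs] at h
  exact h.trans (trdeg_le_of_surjective (Ideal.Quotient.mkₐ E s.head.asIdeal)
    (Ideal.Quotient.mkₐ_surjective _ _))

lemma trdeg_eq_of_isAlgebraic {A C : Type u} [CommRing A] [CommRing C] [IsDomain C]
    [Algebra E A] [Algebra E C] [Algebra A C] [IsScalarTower E A C] [FaithfulSMul A C]
    [FaithfulSMul E A]
    [Algebra.IsAlgebraic A C] : trdeg E A = trdeg E C := by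
  have : IsDomain A := (FaithfulSMul.algebraMap_injective A C).isDomain
  rw [← trdeg_add_eq E A (A := C), trdeg_eq_zero (R := A) (A := C), add_zero]

/-- Noether normalization fixes the transcendence degree. Chains of primes are no longer than that,
and going-up lifts a maximal chain from the polynomial ring. -/
lemma exists_trdeg_eq_and_ringKrullDim_eq (E B : Type u) [Field E] [CommRing B] [IsDomain B]
    [Algebra E B] [FiniteType E B] : ∃ n : ℕ, trdeg E B = n ∧ ringKrullDim B = n := by
  obtain ⟨n, g, hg, hgi⟩ := exists_integral_inj_algHom_of_fg E B
  let : Algebra (MvPolynomial (Fin n) E) B := g.toRingHom.toAlgebra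
  have : IsScalarTower E (MvPolynomial (Fin n) E) B :=
    IsScalarTower.of_algebraMap_eq' g.comp_algebraMap.symm
  have : FaithfulSMul (MvPolynomial (Fin n) E) B :=
    (faithfulSMul_iff_algebraMap_injective _ _).mpr hg
  have : Algebra.IsIntegral (MvPolynomial (Fin n) E) B := ⟨hgi⟩
  have htr : trdeg E B = n := by
    rw [← trdeg_eq_of_isAlgebraic (A := MvPolynomial (Fin n) E)]
    simp [MvPolynomial.trdeg_of_isDomain]
  refine ⟨n, htr, le_antisymm ?_ ?_⟩
  · rw [ringKrullDim, Order.krullDim]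
    refine iSup_le fun s => ?_
    have h := length_add_trdeg_quotient_le (E := E) s
    have h2 := (le_self_add.trans h).trans (trdeg_le_of_surjective
      (Ideal.Quotient.mkₐ E s.head.asIdeal) (Ideal.Quotient.mkₐ_surjective _ _))
    rw [htr] at h2
    exact_mod_cast h2
  · have h1 : ringKrullDim (MvPolynomial (Fin n) E) = n := by
      simp [MvPolynomial.ringKrullDim_of_isNoetherianRing]
    obtain ⟨s, hs⟩ := Order.le_krullDim_iff.mp h1.ge
    obtain ⟨⟨P, hP, hPs⟩⟩ := Ideal.nonempty_primesOver (S := B) s.head.asIdeal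
    obtain ⟨L, hL, -⟩ := Ideal.exists_ltSeries_of_hasGoingUp s P
    rw [← hs, ← hL]
    exact Order.LTSeries.length_le_krullDim L

end Algebra

/-! ### Differentials of fields of characteristic zero -/

namespace KaehlerDifferential

variable {E F : Type u} [Field E] [CharZero E] [Field F] [Algebra E F]

open scoped IntermediateField.algebraAdjoinAdjoin in
-- The extension `E[x] → F` is a localization followed by an algebraic extension, separable in
-- characteristic zero. It is therefore formally étale, and the basis `dxᵢ` of the differentials of
-- the polynomial ring survives base change.
lemma exists_basis_D_of_isTranscendenceBasis {ι : Type u} {x : ι → F}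
    (hx : IsTranscendenceBasis E x) :
    ∃ b : Module.Basis ι F Ω[F⁄E], ∀ i, b i = D E F (x i) := by
  have : CharZero F := charZero_of_injective_algebraMap (algebraMap E F).injective
  have : CharZero (IntermediateField.adjoin E (Set.range x)) :=
    charZero_of_injective_algebraMap (algebraMap E _).injective
  let : Algebra (MvPolynomial ι E) F := (MvPolynomial.aeval x).toAlgebra
  let : Algebra (MvPolynomial ι E) (Algebra.adjoin E (Set.range x)) :=
    hx.1.aevalEquiv.toRingHom.toAlgebra
  have : IsScalarTower (MvPolynomial ι E) (Algebra.adjoin E (Set.range x)) F :=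
    IsScalarTower.of_algebraMap_eq fun p => rfl
  have : IsScalarTower E (MvPolynomial ι E) F :=
    IsScalarTower.of_algebraMap_eq' (MvPolynomial.aeval x).comp_algebraMap.symm
  have : Algebra.FormallyEtale (MvPolynomial ι E) (Algebra.adjoin E (Set.range x)) :=
    .of_equiv (A := MvPolynomial ι E)
      { hx.1.aevalEquiv.toRingEquiv with commutes' := fun _ => rfl }
  have : Algebra.FormallyEtale (Algebra.adjoin E (Set.range x))
      (IntermediateField.adjoin E (Set.range x)) :=
    .of_isLocalization (nonZeroDivisors _)
  have : Algebra.IsAlgebraic (IntermediateField.adjoin E (Set.range x)) F := hx.isAlgebraic_field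
  have : Algebra.FormallyEtale (IntermediateField.adjoin E (Set.range x)) F :=
    .of_isSeparable _ F
  have : Algebra.FormallyEtale (Algebra.adjoin E (Set.range x)) F :=
    .comp _ (IntermediateField.adjoin E (Set.range x)) _
  have : Algebra.FormallyEtale (MvPolynomial ι E) F :=
    .comp _ (Algebra.adjoin E (Set.range x)) _
  have hbc := isBaseChange_of_formallyEtale E (MvPolynomial ι E) F
  refine ⟨hbc.basis (mvPolynomialBasis E ι), fun i => ?_⟩
  rw [hbc.basis_apply, mvPolynomialBasis_apply, map_D]
  exact congrArg _ (MvPolynomial.aeval_X x i)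

end KaehlerDifferential

/-! ### Differentials of regular local rings -/

namespace KaehlerDifferential

lemma rank_eq_trdeg (E F : Type u) [Field E] [CharZero E] [Field F] [Algebra E F] :
    Module.rank F Ω[F⁄E] = Algebra.trdeg E F := by
  obtain ⟨ι, x, hx⟩ := exists_isTranscendenceBasis' (R := E) (A := F)
  obtain ⟨b, -⟩ := exists_basis_D_of_isTranscendenceBasis hx
  rw [← hx.cardinalMk_eq_trdeg, b.mk_eq_rank'']

lemma finrank_of_trdeg_eq {E F : Type u} [Field E] [CharZero E] [Field F] [Algebra E F] {l : ℕ}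
    (h : Algebra.trdeg E F = l) :
    Module.Finite F Ω[F⁄E] ∧ Module.finrank F Ω[F⁄E] = l := by
  rw [← rank_eq_trdeg] at h
  exact ⟨Module.rank_lt_aleph0_iff.mp (h ▸ Cardinal.natCast_lt_aleph0),
    Module.finrank_eq_of_rank_eq h⟩

section Localization

variable {E R S : Type*} [CommRing E] [CommRing R] [CommRing S] [Algebra E R] [Algebra E S]
  [Algebra R S] [IsScalarTower E R S]

lemma span_range_D_comp_algebraMap_eq_top {ι : Type*} {a : ι → R} (M : Submonoid R)
    [IsLocalization M S] (t : R) (ht : IsUnit (algebraMap R S t))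
    (h : ∀ x : R, t • D E R x ∈ Submodule.span R (Set.range fun i => D E R (a i))) :
    Submodule.span S (Set.range fun i => D E S (algebraMap R S (a i))) = ⊤ := by
  rw [eq_top_iff, ← span_range_map_derivation_of_isLocalization E R S M, Submodule.span_le]
  rintro _ ⟨x, rfl⟩
  have h1 := Submodule.mem_map_of_mem (f := map E E R S) (h x)
  rw [Submodule.map_span, ← Set.range_comp] at h1
  have h2 := Submodule.span_le_restrictScalars R S _ h1
  simp only [Function.comp_def, map_D, map_smul] at h2
  rw [Submodule.restrictScalars_mem, ← algebraMap_smul S t] at h2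
  simpa using (Submodule.smul_mem_iff_of_isUnit _ ht).mp h2

lemma span_range_D_comp_algebraMap_eq_top' {ι : Type*} {a : ι → R} (M : Submonoid R)
    [IsLocalization M S] (h : Submodule.span R (Set.range fun i => D E R (a i)) = ⊤) :
    Submodule.span S (Set.range fun i => D E S (algebraMap R S (a i))) = ⊤ :=
  span_range_D_comp_algebraMap_eq_top M 1 (by simp) fun x => by rw [h]; trivial

end Localization

/-- If finitely many differentials generate the differentials of a localization, then they do so
after inverting one element. -/
lemma exists_smul_D_mem_span {E B R : Type*} [CommRing E] [CommRing B] [CommRing R] [Algebra E B]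
    [Algebra E R] [Algebra B R] [IsScalarTower E B R] [Algebra.FiniteType E B] (M : Submonoid B)
    [IsLocalization M R] {ι : Type*} (a : ι → B)
    (h : Submodule.span R (Set.range fun i => D E R (algebraMap B R (a i))) = ⊤) :
    ∃ t ∈ M, ∀ x : B, t • D E B x ∈ Submodule.span B (Set.range fun i => D E B (a i)) := by
  set N := Submodule.span B (Set.range fun i => D E B (a i)) with hN
  have hloc : N.localized' R M (map E E B R) = ⊤ := by
    rw [hN, Submodule.localized'_span, ← h, ← Set.range_comp]
    simp [Function.comp_def]
  have key : ∀ w : Ω[B⁄E], ∃ t ∈ M, t • w ∈ N := by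
    intro w
    have hw : map E E B R w ∈ N.localized' R M (map E E B R) := by rw [hloc]; trivial
    obtain ⟨n, hn, s, hs⟩ := (Submodule.mem_localized' ..).mp hw
    rw [IsLocalizedModule.mk'_eq_iff, Submonoid.smul_def, ← map_smul] at hs
    obtain ⟨c, hc⟩ := IsLocalizedModule.exists_of_eq (S := M) hs
    refine ⟨c * s, (c * s).2, ?_⟩
    rw [mul_smul]
    change c • (s : B) • w ∈ N
    rw [← hc]
    exact N.smul_mem _ hn
  -- The differentials are finitely generated, so the product of one denominator for each generator
  -- serves all elements.
  obtain ⟨G, hG⟩ := (Module.Finite.fg_top (R := B) (M := Ω[B⁄E]))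
  choose t ht ht' using key
  refine ⟨∏ g ∈ G, t g, prod_mem fun g _ => ht g, fun x => ?_⟩
  have hle : (⊤ : Submodule B Ω[B⁄E]) ≤ N.comap (LinearMap.lsmul B _ (∏ g ∈ G, t g)) := by
    rw [← hG, Submodule.span_le]
    intro g hg
    change (∏ g ∈ G, t g) • g ∈ N
    obtain ⟨c, hc⟩ := Finset.dvd_prod_of_mem t hg
    rw [hc, mul_comm, mul_smul]
    exact N.smul_mem _ (ht' g)
  exact hle trivial

section Regular

open IsLocalRing

variable {E R K : Type u} [Field E] [CharZero E] [CommRing R] [IsRegularLocalRing R]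
  [Algebra E R]

/-- In the conormal sequence `𝔪/𝔪² → k ⊗ Ω_R → Ω_k`, regularity bounds the image of the left term by
`n`, and characteristic zero gives the right term dimension `r`. -/
lemma finrank_residueField_tensor_le {n r : ℕ}
    (hn : ringKrullDim R = n) (hr : Algebra.trdeg E (ResidueField R) = r) [Module.Finite R Ω[R⁄E]] :
    Module.finrank (ResidueField R) (ResidueField R ⊗[R] Ω[R⁄E]) ≤ n + r := by
  obtain ⟨hfin, hfr⟩ := finrank_of_trdeg_eq hr
  set k := ResidueField R
  let φ := mapBaseChange E R k
  have hker : Module.finrank k (LinearMap.ker φ) ≤ n := by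
    have hfg := (maximalIdeal R).fg_of_isNoetherianRing
    obtain ⟨G, hGc, hG⟩ : ∃ G : Finset R, G.card = n ∧ Ideal.span (G : Set R) = maximalIdeal R := by
      have h1 := IsRegularLocalRing.spanFinrank_maximalIdeal (R := R)
      rw [hn] at h1
      have h1 : (maximalIdeal R).spanFinrank = n := by exact_mod_cast h1
      have hf := Submodule.FG.finite_generators hfg
      refine ⟨hf.toFinset, ?_, by simpa using Submodule.span_generators _⟩
      rw [← h1, ← Submodule.FG.generators_ncard hfg, Set.ncard_eq_toFinset_card _ hf]
    have h0 : ∀ y ∈ maximalIdeal R, algebraMap R k y = 0 := fun y hy =>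
      (IsLocalRing.residue_eq_zero_iff y).mpr hy
    have key : ∀ z ∈ maximalIdeal R, (1 : k) ⊗ₜ[R] D E R z ∈
        Submodule.span k ((fun g => (1 : k) ⊗ₜ[R] D E R g) '' G) := by
      intro z hz
      rw [← hG] at hz
      induction hz using Submodule.span_induction with
      | mem x hx => exact Submodule.subset_span ⟨x, hx, rfl⟩
      | zero => simp
      | add x y _ _ hx hy =>
        rw [map_add, TensorProduct.tmul_add]
        exact add_mem hx hy
      | smul c x hx' hx =>
        rw [smul_eq_mul, Derivation.leibniz, TensorProduct.tmul_add, TensorProduct.tmul_smul,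
          ← TensorProduct.smul_tmul, ← Algebra.algebraMap_eq_smul_one x,
          h0 x (hG ▸ hx'), TensorProduct.zero_tmul, add_zero, ← algebraMap_smul k c]
        exact Submodule.smul_mem _ _ hx
    have hle : LinearMap.ker φ ≤ Submodule.span k ((fun g => (1 : k) ⊗ₜ[R] D E R g) '' G) := by
      intro w hw
      have hw' : w ∈ LinearMap.range (kerCotangentToTensor E R k) := by
        rw [range_kerCotangentToTensor E R k IsLocalRing.residue_surjective]
        exact hw
      obtain ⟨z, rfl⟩ := hw'
      obtain ⟨⟨z, hz⟩, rfl⟩ := Ideal.toCotangent_surjective _ z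
      rw [kerCotangentToTensor_toCotangent]
      exact key z ((IsLocalRing.residue_eq_zero_iff z).mp hz)
    classical
    rw [← Finset.coe_image] at hle
    exact (Submodule.finrank_mono hle).trans ((finrank_span_finset_le_card _).trans
      (Finset.card_image_le.trans hGc.le))
  have hrange : Module.finrank k (LinearMap.range φ) ≤ r := hfr ▸ Submodule.finrank_le _
  have := LinearMap.finrank_range_add_finrank_ker φ
  change Module.finrank k (k ⊗[R] Ω[R⁄E]) ≤ n + r
  omega

/-- Let `R` be a regular local `E`-algebra with field of fractions `K`, such that the dimension
inequality `dim R + trdeg k ≤ trdeg K = l` holds. If the differentials of `R` are finitely generated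
and generated by the differentials of the elements of `S`, then they are generated by the
differentials of `l` elements of `S`, and the dimension inequality is an equality. -/
theorem exists_span_range_D_eq_top [IsDomain R] [Field K] [Algebra E K] [Algebra R K]
    [IsScalarTower E R K] [IsFractionRing R K] [Module.Finite R Ω[R⁄E]] {n r l : ℕ}
    (hn : ringKrullDim R = n) (hr : Algebra.trdeg E (ResidueField R) = r)
    (hl : Algebra.trdeg E K = l) (hle : n + r ≤ l) {S : Set R}
    (hS : Submodule.span R (D E R '' S) = ⊤) :
    n + r = l ∧ ∃ a : Fin l → R, (∀ i, a i ∈ S) ∧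
      Submodule.span R (Set.range fun i => D E R (a i)) = ⊤ := by
  set k := ResidueField R
  set q := Module.finrank k (k ⊗[R] Ω[R⁄E]) with hq
  have hq1 : q ≤ n + r := finrank_residueField_tensor_le hn hr
  obtain ⟨a, ha, haspan⟩ : ∃ a : Fin q → R, (∀ i, a i ∈ S) ∧
      Submodule.span R (Set.range fun i => D E R (a i)) = ⊤ := by
    have hspan : Submodule.span k ((fun s => (1 : k) ⊗ₜ[R] D E R s) '' S) = ⊤ := by
      rw [eq_top_iff]
      rintro w -
      induction w with
      | zero => exact zero_mem _
      | add x y hx hy => exact add_mem hx hy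
      | tmul c w =>
        have hw : w ∈ Submodule.span R (D E R '' S) := by rw [hS]; trivial
        rw [← mul_one c, ← smul_eq_mul, ← TensorProduct.smul_tmul']
        refine Submodule.smul_mem _ _ ?_
        have := Submodule.mem_map_of_mem (f := TensorProduct.mk R k Ω[R⁄E] 1) hw
        rw [Submodule.map_span, ← Set.image_comp] at this
        exact Submodule.span_le_restrictScalars R k _ this
    -- A basis of the fiber over `k` is chosen among the differentials of elements of `S`; Nakayama
    -- then lifts generation to `R`.
    obtain ⟨t, ht, hts, hti⟩ := exists_linearIndependent k ((fun s => (1 : k) ⊗ₜ[R] D E R s) '' S)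
    rw [hspan] at hts
    let b := Module.Basis.mk hti (by simpa using hts.ge)
    have : Fintype t := FiniteDimensional.fintypeBasisIndex b
    have hcard : Fintype.card t = q := (Module.finrank_eq_card_basis b).symm
    let e := Fintype.equivFinOfCardEq hcard
    choose c hcS hc using fun x : t => ht x.2
    refine ⟨fun i => c (e.symm i), fun i => hcS _, ?_⟩
    have := span_eq_top_of_tmul_eq_basis (R := R) (fun x : t => D E R (c x)) b fun x => by
      simpa [b] using hc x
    rw [← this]
    congr 1
    exact (e.symm.surjective.range_comp (fun x => D E R (c x)))
  obtain ⟨hfin, hfr⟩ := finrank_of_trdeg_eq hl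
  have h1 := span_range_D_comp_algebraMap_eq_top' (S := K) (nonZeroDivisors R) haspan
  -- The same `q` differentials span the `l`-dimensional `Ω_{K/E}`. With `q ≤ n + r ≤ l` all these
  -- numbers coincide.
  have h2 : l ≤ q := by
    rw [← hfr, ← finrank_top, ← h1]
    exact (finrank_range_le_card _).trans (by simp)
  obtain rfl : l = q := by omega
  exact ⟨by omega, a, ha, haspan⟩

end Regular

end KaehlerDifferential

/-! ### Generators of modules of pluri-differential forms -/

namespace PluriForm

open KaehlerDifferential (D)

section Generator

variable (E : Type u) {R : Type u} [CommRing E] [CommRing R] [Algebra E R] {l : ℕ} (m : ℕ)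

/-- The form `(da₁ ∧ ⋯ ∧ daₗ)^{⊗ m}`. -/
def generator (a : Fin l → R) : PluriForm E R l m :=
  PiTensorProduct.tprod R fun _ => exteriorPower.ιMulti R l fun i => D E R (a i)

variable {E m}

/-- A wedge of `l` factors drawn from `l` generators either repeats one and vanishes, or is a
permutation of the full wedge. -/
lemma exists_eq_smul_ιMulti {M : Type*} [AddCommGroup M] [Module R M] {v : Fin l → M}
    (hv : Submodule.span R (Set.range v) = ⊤) (x : ⋀[R]^l M) :
    ∃ c : R, x = c • exteriorPower.ιMulti R l v := by
  suffices h : (⊤ : Submodule R (⋀[R]^l M)) ≤ Submodule.span R {exteriorPower.ιMulti R l v} by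
    obtain ⟨c, hc⟩ := Submodule.mem_span_singleton.mp (h (Submodule.mem_top (x := x)))
    exact ⟨c, hc.symm⟩
  rw [← exteriorPower.ιMulti_span_of_span R l M hv, Submodule.span_le]
  rintro _ ⟨w, hw, rfl⟩
  choose σ hσ using fun i => hw ⟨i, rfl⟩
  obtain rfl : v ∘ σ = w := funext hσ
  by_cases hinj : Function.Injective σ
  · let τ : Equiv.Perm (Fin l) := Equiv.ofBijective σ (Finite.injective_iff_bijective.mp hinj)
    change exteriorPower.ιMulti R l (v ∘ τ) ∈ _
    rw [AlternatingMap.map_perm, SetLike.mem_coe]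
    rcases Int.units_eq_one_or (Equiv.Perm.sign τ) with h | h <;>
      simp [h, Submodule.mem_span_singleton_self]
  · obtain ⟨i, j, hij, hne⟩ : ∃ i j, σ i = σ j ∧ i ≠ j := by
      simpa [Function.Injective] using hinj
    rw [AlternatingMap.map_eq_zero_of_eq (exteriorPower.ιMulti R l) (v ∘ σ) (congrArg v hij) hne]
    exact zero_mem _

lemma exists_eq_smul_generator {a : Fin l → R}
    (ha : Submodule.span R (Set.range fun i => D E R (a i)) = ⊤) (x : PluriForm E R l m) :
    ∃ c : R, x = c • generator E m a := by
  suffices h : (⊤ : Submodule R (PluriForm E R l m)) ≤ Submodule.span R {generator E m a} by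
    obtain ⟨c, hc⟩ := Submodule.mem_span_singleton.mp (h (Submodule.mem_top (x := x)))
    exact ⟨c, hc.symm⟩
  rw [← PiTensorProduct.span_tprod_eq_top, Submodule.span_le]
  rintro _ ⟨w, rfl⟩
  choose c hc using fun i => exists_eq_smul_ιMulti ha (w i)
  refine Submodule.mem_span_singleton.mpr ⟨∏ i, c i, ?_⟩
  rw [generator, ← MultilinearMap.map_smul_univ]
  exact congrArg _ (funext hc).symm

variable {S : Type u} [CommRing S] [Algebra E S] [Algebra R S] [IsScalarTower E R S]

@[simp]
lemma linearMap_generator (a : Fin l → R) :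
    linearMap E R S l m (generator E m a) = generator E m fun i => algebraMap R S (a i) := by
  simp [generator]

end Generator

section Field

variable {E K : Type u} [Field E] [Field K] [Algebra E K] {l m : ℕ}

/-- The determinant of the basis, applied in each of the `m` tensor factors and multiplied out,
takes the value one on the generator. -/
lemma generator_ne_zero (hl : Module.finrank K Ω[K⁄E] = l) {a : Fin l → K}
    (ha : Submodule.span K (Set.range fun i => D E K (a i)) = ⊤) :
    generator E m a ≠ 0 := by
  let b := basisOfTopLeSpanOfCardEqFinrank (fun i => D E K (a i)) ha.ge (by simp [hl])
  let ψ : (⋀[K]^l Ω[K⁄E]) →ₗ[K] K := exteriorPower.alternatingMapLinearEquiv b.det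
  have hψ : ψ (exteriorPower.ιMulti K l fun i => D E K (a i)) = 1 := by
    have : (fun i => D E K (a i)) = b := by simp [b]
    rw [this]
    simp [ψ, b.det_self]
  intro h
  have := congrArg (PiTensorProduct.lift
    ((MultilinearMap.mkPiAlgebra K (Fin m) K).compLinearMap fun _ => ψ)) h
  simp [generator, hψ] at this

variable {R : Type u} [CommRing R] [Algebra E R] [Algebra R K] [IsScalarTower E R K]

lemma linearMap_injective [FaithfulSMul R K] (hl : Module.finrank K Ω[K⁄E] = l) {a : Fin l → R}
    (ha : Submodule.span R (Set.range fun i => D E R (a i)) = ⊤)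
    (haK : Submodule.span K (Set.range fun i => D E K (algebraMap R K (a i))) = ⊤) :
    Function.Injective (linearMap E R K l m) := by
  refine (injective_iff_map_eq_zero _).mpr fun x hx => ?_
  obtain ⟨c, rfl⟩ := exists_eq_smul_generator ha x
  rw [map_smul, linearMap_generator, ← algebraMap_smul K c] at hx
  have := (smul_eq_zero.mp hx).resolve_right (generator_ne_zero hl haK)
  rw [FaithfulSMul.algebraMap_eq_zero_iff] at this
  rw [this, zero_smul]

/-- This reduces every question about regularity of forms to integrality of the coefficient `f`. -/
lemma smul_generator_mem_range_iff (hl : Module.finrank K Ω[K⁄E] = l) {a : Fin l → R}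
    (ha : Submodule.span R (Set.range fun i => D E R (a i)) = ⊤)
    (haK : Submodule.span K (Set.range fun i => D E K (algebraMap R K (a i))) = ⊤) (f : K) :
    (f • generator E m fun i => algebraMap R K (a i)) ∈ LinearMap.range (linearMap E R K l m) ↔
      ∃ c : R, algebraMap R K c = f := by
  constructor
  · rintro ⟨x, hx⟩
    obtain ⟨c, rfl⟩ := exists_eq_smul_generator ha x
    rw [map_smul, linearMap_generator, ← algebraMap_smul K c] at hx
    exact ⟨c, smul_left_injective K (generator_ne_zero hl haK) hx⟩
  · rintro ⟨c, rfl⟩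
    exact ⟨c • generator E m a, by rw [map_smul, linearMap_generator, algebraMap_smul]⟩

variable (E K l m) in
lemma nonempty_linearEquiv [CharZero E] (hl : Algebra.trdeg E K = l) :
    Nonempty (PluriForm E K l m ≃ₗ[K] K) := by
  obtain ⟨-, hfr⟩ := KaehlerDifferential.finrank_of_trdeg_eq hl
  obtain ⟨ι, x, hx⟩ := exists_isTranscendenceBasis' (R := E) (A := K)
  obtain ⟨b, hb⟩ := KaehlerDifferential.exists_basis_D_of_isTranscendenceBasis hx
  obtain ⟨e⟩ := Cardinal.lift_mk_eq'.mp
    (show Cardinal.lift.{0} (Cardinal.mk ι) = Cardinal.lift.{u} (Cardinal.mk (Fin l)) by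
      rw [hx.cardinalMk_eq_trdeg, hl, Cardinal.mk_fin]; simp)
  have ha : Submodule.span K (Set.range fun i => D E K (x (e.symm i))) = ⊤ := by
    rw [← b.span_eq, ← e.symm.surjective.range_comp b]
    simp [Function.comp_def, hb]
  obtain ⟨ω, hω⟩ : ∃ ω : PluriForm E K l m, ω = generator E m fun i => x (e.symm i) := ⟨_, rfl⟩
  have hne : ω ≠ 0 := hω ▸ generator_ne_zero hfr ha
  refine ⟨(LinearEquiv.ofBijective (LinearMap.toSpanSingleton K (PluriForm E K l m) ω)
    ⟨LinearMap.ker_eq_bot.mp (LinearMap.ker_toSpanSingleton K hne),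
      fun y => ?_⟩).symm⟩
  obtain ⟨c, hc⟩ := exists_eq_smul_generator ha y
  exact ⟨c, by rw [hc, ← hω]; rfl⟩

end Field

end PluriForm

/-! ### Regularity at a divisorial valuation ring -/

namespace ValuationSubring

variable {K : Type u} [Field K] (A : ValuationSubring K) [IsDiscreteValuationRing A]

omit [IsDiscreteValuationRing A] in
lemma algebraMap_completed_completedFrac_injective :
    Function.Injective (algebraMap A.Completed A.CompletedFrac) :=
  IsLocalization.injective _ le_rfl

lemma algebraMap_completedFrac_coe (a : A) :
    algebraMap K A.CompletedFrac a =
      algebraMap A.Completed A.CompletedFrac (algebraMap A A.Completed a) :=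
  IsLocalization.lift_eq (M := nonZeroDivisors A) A.isUnit_algebraMap_completedFrac a

/-- `Â ∩ K = A`. -/
lemma mem_of_algebraMap_completedFrac_eq {x : K} {c : A.Completed}
    (h : algebraMap A.Completed A.CompletedFrac c = algebraMap K A.CompletedFrac x) : x ∈ A := by
  by_contra hx
  have hx0 : x ≠ 0 := fun h0 => hx (h0 ▸ A.zero_mem)
  have hinv : x⁻¹ ∈ A := (A.mem_or_inv_mem x).resolve_left hx
  set b : A := ⟨x⁻¹, hinv⟩
  have hb : b ∈ IsLocalRing.maximalIdeal A := by
    rw [IsLocalRing.mem_maximalIdeal]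
    rintro ⟨v, hv⟩
    have h1 : (v : A) * (↑v⁻¹ : A) = 1 := v.mul_inv
    have h2 : x⁻¹ * ((↑v⁻¹ : A) : K) = 1 := by
      rw [hv] at h1
      exact congrArg Subtype.val h1
    have h3 : x = ((↑v⁻¹ : A) : K) := by
      field_simp at h2
      exact h2.symm
    exact hx (h3 ▸ (↑v⁻¹ : A).2)
  have hcb : c * algebraMap A A.Completed b = 1 := by
    apply A.algebraMap_completed_completedFrac_injective
    rw [map_mul, map_one, h, ← algebraMap_completedFrac_coe, ← map_mul]
    change algebraMap K A.CompletedFrac (x * x⁻¹) = 1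
    rw [mul_inv_cancel₀ hx0, map_one]
  -- If `x ∉ A`, then `x⁻¹` lies in the maximal ideal and becomes a unit of `Â`; modulo the maximal
  -- ideal this reads `0 = 1`.
  have h0 := congrArg (AdicCompletion.evalOneₐ (IsLocalRing.maximalIdeal A)) hcb
  rw [map_mul, AlgHom.commutes, map_one, Ideal.Quotient.algebraMap_eq,
    Ideal.Quotient.eq_zero_iff_mem.mpr hb, mul_zero] at h0
  exact one_ne_zero h0.symm

/-- For an `A`-submodule `I` of `K` we have `ÂI ∩ K = I`. -/
lemma mem_of_algebraMap_mem_span (I : Submodule A K) {x : K}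
    (hx : algebraMap K A.CompletedFrac x ∈
      Submodule.span A.Completed (algebraMap K A.CompletedFrac '' I)) : x ∈ I := by
  have key : ∀ q ∈ Submodule.span A.Completed (algebraMap K A.CompletedFrac '' I),
      ∃ i ∈ I, ∃ c : A.Completed, q = c • algebraMap K A.CompletedFrac i := by
    intro q hq
    induction hq using Submodule.span_induction with
    | mem q hq =>
      obtain ⟨i, hi, rfl⟩ := hq
      exact ⟨i, hi, 1, (one_smul _ _).symm⟩
    | zero => exact ⟨0, I.zero_mem, 0, by simp⟩
    | smul c q _ h =>
      obtain ⟨i, hi, d, rfl⟩ := h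
      exact ⟨i, hi, c * d, (mul_smul _ _ _).symm⟩
    | add p q _ _ hp hq =>
      -- Of two nonzero elements of `K` one divides the other over the valuation ring, so each sum
      -- in the span collapses to a single multiple `c • i`.
      have aux : ∀ i ∈ I, ∀ j ∈ I, ∀ c d : A.Completed, (∃ a : A, j = a * i) →
          ∃ k ∈ I, ∃ e : A.Completed, c • algebraMap K A.CompletedFrac i +
            d • algebraMap K A.CompletedFrac j = e • algebraMap K A.CompletedFrac k := by
        rintro i hi _ - c d ⟨a, rfl⟩
        refine ⟨i, hi, c + d * algebraMap A A.Completed a, ?_⟩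
        rw [map_mul, algebraMap_completedFrac_coe, add_smul, mul_smul, Algebra.smul_def
          (algebraMap A A.Completed a)]
      obtain ⟨i, hi, c, rfl⟩ := hp
      obtain ⟨j, hj, d, rfl⟩ := hq
      by_cases hi0 : i = 0
      · subst hi0
        exact ⟨j, hj, d, by simp⟩
      by_cases hj0 : j = 0
      · subst hj0
        exact ⟨i, hi, c, by simp⟩
      rcases A.mem_or_inv_mem (j / i) with h | h
      · exact aux i hi j hj c d ⟨⟨_, h⟩, (div_mul_cancel₀ j hi0).symm⟩
      · rw [add_comm]
        exact aux j hj i hi d c ⟨⟨_, h⟩, by field_simp⟩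
  obtain ⟨i, hi, c, hc⟩ := key _ hx
  have : Nontrivial A.CompletedFrac := inferInstance
  by_cases hi0 : i = 0
  · rw [hi0, map_zero, smul_zero] at hc
    rw [(map_eq_zero _).mp hc]
    exact I.zero_mem
  have hmem : x / i ∈ A := by
    refine A.mem_of_algebraMap_completedFrac_eq (c := c) ?_
    have hu : IsUnit (algebraMap K A.CompletedFrac i) := (isUnit_iff_ne_zero.mpr hi0).map _
    rw [← hu.mul_left_inj, ← map_mul, div_mul_cancel₀ _ hi0, hc, Algebra.smul_def]
  have := I.smul_mem ⟨_, hmem⟩ hi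
  rwa [show (⟨x / i, hmem⟩ : A) • i = x / i * i from rfl, div_mul_cancel₀ _ hi0] at this

end ValuationSubring

namespace DivisorialValuationRing

variable {E K : Type u} [Field E] [CharZero E] [Field K] [Algebra E K] {l : ℕ}
  (A : DivisorialValuationRing E K l)

/-- A trivialization of the line of rational forms turns the forms of `A` into an `A`-submodule `I`
of `K`, where `ÂI ∩ K = I` applies. -/
lemma one_tmul_mem_completedForms_iff (hl : Algebra.trdeg E K = l) {m : ℕ}
    (η : PluriForm E K l m) : (1 : A.ring.CompletedFrac) ⊗ₜ[K] η ∈ A.completedForms m ↔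
      η ∈ LinearMap.range (PluriForm.linearMap E A.ring K l m) := by
  constructor
  · intro h
    obtain ⟨e⟩ := PluriForm.nonempty_linearEquiv E K l m hl
    let Φ : A.ring.CompletedFrac ⊗[K] PluriForm E K l m →ₗ[A.ring.CompletedFrac]
      A.ring.CompletedFrac := (TensorProduct.AlgebraTensorModule.rid K _ _).toLinearMap ∘ₗ
        e.toLinearMap.baseChange A.ring.CompletedFrac
    have hΦ : ∀ η, Φ (1 ⊗ₜ η) = algebraMap K _ (e η) := by
      intro η
      simp [Φ, Algebra.algebraMap_eq_smul_one]
    have h1 := Submodule.mem_map_of_mem (f := Φ.restrictScalars A.ring.Completed) h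
    rw [completedForms, Submodule.map_span, ← Set.range_comp] at h1
    have h2 := A.ring.mem_of_algebraMap_mem_span (x := e η)
      ((LinearMap.range (PluriForm.linearMap E A.ring K l m)).map
        (e.toLinearMap.restrictScalars A.ring)) (by
      rw [← hΦ]
      refine Submodule.span_mono ?_ h1
      rintro _ ⟨w, rfl⟩
      exact ⟨_, ⟨_, ⟨w, rfl⟩, rfl⟩, (hΦ _).symm⟩)
    obtain ⟨ξ, hξ, hξ'⟩ := h2
    rwa [e.injective hξ'] at hξ
  · rintro ⟨w, rfl⟩
    exact Submodule.subset_span ⟨w, rfl⟩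

end DivisorialValuationRing

/-! ### Recognizing a sheafification of modules -/

/-- A locally bijective linear map from a presheaf of modules to a sheaf of modules identifies the
sheaf with the sheafification of the presheaf. -/
lemma PresheafOfModules.nonempty_sheafification_iso {C : Type u} [Category.{u} C]
    {J : GrothendieckTopology C} {R : Sheaf J RingCat.{u}} (P : PresheafOfModules.{u} R.obj)
    (F : SheafOfModules.{u} R) (f : P.presheaf ⟶ F.val.presheaf)
    (hf : ∀ (U : Cᵒᵖ) (r : R.obj.obj U) (x : P.obj U),
      f.app U (r • x : P.obj U) = (r • (show F.val.obj U from f.app U x) : F.val.obj U))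
    [J.WEqualsLocallyBijective AddCommGrpCat.{u}] [HasSheafify J AddCommGrpCat.{u}]
    [Presheaf.IsLocallyInjective J f] [Presheaf.IsLocallySurjective J f] :
    Nonempty ((PresheafOfModules.sheafification (𝟙 R.obj)).obj P ≅ F) := by
  let g : P ⟶ (PresheafOfModules.restrictScalars (𝟙 R.obj)).obj
      ((SheafOfModules.forget _).obj F) := PresheafOfModules.homMk f hf
  obtain ⟨ψ, hψ⟩ := (PresheafOfModules.sheafificationHomEquiv (𝟙 R.obj)).surjective g
  have h := PresheafOfModules.toPresheaf_map_sheafificationHomEquiv_def (𝟙 R.obj) ψ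
  rw [hψ] at h
  -- `f` is the sheafification unit followed by `ψ`. Sheafification inverts `f` and the unit, hence
  -- also `ψ`, which is a map of sheaves.
  have h1 : J.W f := J.W_of_isLocallyBijective f
  have h2 : J.W (CategoryTheory.toSheafify J P.presheaf ≫
      (PresheafOfModules.toPresheaf R.obj).map ψ.val) := h ▸ h1
  have h3 := MorphismProperty.of_precomp _ _ _ (J.W_toSheafify P.presheaf) h2
  have h4 : IsIso ((SheafOfModules.toSheaf R).map ψ) :=
    (J.W_sheafToPresheaf_map_iff_isIso ((SheafOfModules.toSheaf R).map ψ)).mp h3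
  have : IsIso ψ := isIso_of_reflects_iso ψ (SheafOfModules.toSheaf R)
  exact ⟨asIso ψ⟩

/-! ### Dimension and transcendence degree of the function field -/

namespace AlgebraicGeometry.Scheme

lemma topologicalKrullDim_eq_iSup_stalk (X : Scheme.{u}) :
    topologicalKrullDim X = ⨆ x : X, ringKrullDim (X.presheaf.stalk x) := by
  rw [topologicalKrullDim, Order.krullDim_eq_of_orderIso (irreducibleSetEquivPoints (α := X)),
    Order.krullDim_eq_iSup_coheight]
  exact iSup_congr fun x => (ringKrullDim_stalk_eq_coheight x).symm

lemma ringKrullDim_stalk_le_of_isAffineOpen {X : Scheme.{u}} {U : X.Opens} (hU : IsAffineOpen U)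
    (x : U) : ringKrullDim (X.presheaf.stalk (x : X)) ≤ ringKrullDim Γ(X, U) := by
  have h := hU.isLocalization_stalk x
  rw [IsLocalization.AtPrime.ringKrullDim_eq_height (hU.primeIdealOf x).asIdeal
    (X.presheaf.stalk (x : X))]
  exact Ideal.height_le_ringKrullDim_of_ne_top (hU.primeIdealOf x).2.ne_top

lemma ringKrullDim_le_topologicalKrullDim_of_isAffineOpen {X : Scheme.{u}} {U : X.Opens}
    (hU : IsAffineOpen U) : ringKrullDim Γ(X, U) ≤ topologicalKrullDim X := by
  rw [← PrimeSpectrum.topologicalKrullDim_eq_ringKrullDim]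
  exact hU.fromSpec.isOpenEmbedding.isInducing.topologicalKrullDim_le

section BaseField

variable (E : Type u) [Field E] (X : Scheme.{u}) [X.Over (Spec (.of E))]

instance [IsIntegral X] (U : X.Opens) [Nonempty U] : IsScalarTower E Γ(X, U) X.functionField :=
  IsScalarTower.of_algebraMap_eq fun e => by
    change X.presheaf.germ ⊤ (genericPoint X) trivial (X.baseHom E ⊤ e) =
      X.presheaf.germ U _ _ (X.baseHom E U e)
    rw [← map_baseHom E X (homOfLE le_top : U ⟶ ⊤), TopCat.Presheaf.germ_res_apply]

lemma finiteType_of_isAffineOpen [LocallyOfFiniteType (X ↘ Spec (.of E))] {U : X.Opens}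
    (hU : IsAffineOpen U) : Algebra.FiniteType E Γ(X, U) := by
  have h := LocallyOfFiniteType.finiteType_appLE (f := X ↘ Spec (.of E))
    (isAffineOpen_top _) hU le_top
  have h2 := h.comp (RingHom.FiniteType.of_surjective _
    (Scheme.ΓSpecIso (.of E)).symm.commRingCatIsoToRingEquiv.surjective)
  exact h2

/-- Every nonempty affine open has dimension `trdeg K`. The dimension of `X` is at least that of an
affine open, and as the supremum of the dimensions of the stalks it is no larger. -/
lemma trdeg_functionField [IsIntegral X] [LocallyOfFiniteType (X ↘ Spec (.of E))] {l : ℕ}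
    (hl : topologicalKrullDim X = l) : Algebra.trdeg E X.functionField = l := by
  have key : ∀ (U : X.Opens) (hU : IsAffineOpen U) [Nonempty U], ∃ n : ℕ,
      Algebra.trdeg E X.functionField = n ∧ ringKrullDim Γ(X, U) = n := by
    intro U hU _
    have := finiteType_of_isAffineOpen E X hU
    have := functionField_isFractionRing_of_isAffineOpen X U hU
    have hinj := IsFractionRing.injective Γ(X, U) X.functionField
    obtain ⟨n, hn, hn'⟩ := Algebra.exists_trdeg_eq_and_ringKrullDim_eq E Γ(X, U)
    refine ⟨n, ?_, hn'⟩
    rw [← hn]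
    have : Algebra.IsAlgebraic Γ(X, U) X.functionField :=
      IsLocalization.isAlgebraic _ (nonZeroDivisors Γ(X, U))
    exact (Algebra.trdeg_eq_of_isAlgebraic (E := E) (A := Γ(X, U)) (C := X.functionField)).symm
  have hex : ∀ x : X, ∃ U : X.Opens, IsAffineOpen U ∧ x ∈ U := fun x => by
    obtain ⟨U, hU, hx, -⟩ := X.isBasis_affineOpens.exists_subset_of_mem_open
      (Set.mem_univ x) isOpen_univ
    obtain ⟨V, hV, rfl⟩ := hU
    exact ⟨V, hV, hx⟩
  obtain ⟨U, hU, hx⟩ := hex (genericPoint X)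
  have : Nonempty U := ⟨⟨_, hx⟩⟩
  obtain ⟨n, hn, hn'⟩ := key U hU
  rw [hn]
  have hle : (n : WithBot ℕ∞) ≤ l :=
    hn' ▸ hl ▸ ringKrullDim_le_topologicalKrullDim_of_isAffineOpen hU
  have hge : (l : WithBot ℕ∞) ≤ n := by
    rw [← hl, topologicalKrullDim_eq_iSup_stalk]
    refine iSup_le fun x => ?_
    obtain ⟨V, hV, hx⟩ := hex x
    have : Nonempty V := ⟨⟨_, hx⟩⟩
    obtain ⟨k, hk, hk'⟩ := key V hV
    rw [hn] at hk
    have : n = k := by exact_mod_cast hk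
    subst this
    exact hk' ▸ ringKrullDim_stalk_le_of_isAffineOpen hV ⟨x, hx⟩
  have h1 : n ≤ l := by exact_mod_cast hle
  have h2 : l ≤ n := by exact_mod_cast hge
  exact_mod_cast h1.antisymm h2

end BaseField

end AlgebraicGeometry.Scheme

/-! ### Centers of valuation rings and formal prime divisors -/

namespace AlgebraicGeometry.Scheme

/-- The valuation ring `A` of the function field of `X` has a center in `U`: the morphism
`Spec K ⟶ X` extends to `Spec A`, and sends the closed point into `U`. -/
def HasCenterIn (X : Scheme.{u}) [IsIntegral X] (A : ValuationSubring X.functionField)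
    (U : X.Opens) : Prop :=
  ∃ g : Spec (.of A) ⟶ X,
    Spec.map (CommRingCat.ofHom (algebraMap A X.functionField)) ≫ g =
      X.fromSpecStalk (genericPoint X) ∧ g (IsLocalRing.closedPoint A) ∈ U

lemma specMap_closedPoint {R S : Type u} [CommRing R] [CommRing S] [IsLocalRing R] [IsLocalRing S]
    (f : R →+* S) [IsLocalHom f] :
    Spec.map (CommRingCat.ofHom f) (IsLocalRing.closedPoint S) = IsLocalRing.closedPoint R :=
  IsLocalRing.comap_closedPoint f

/-- A section of the structure sheaf near the closed point of a morphism from the spectrum of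
a valuation ring of the function field lies in the valuation ring. -/
lemma exists_ringHom_of_hasCenterIn {X : Scheme.{u}} [IsIntegral X]
    {A : ValuationSubring X.functionField} {U : X.Opens} [Nonempty U] (h : X.HasCenterIn A U) :
    ∃ ψ : Γ(X, U) →+* A, ∀ s, (ψ s : X.functionField) = algebraMap _ X.functionField s := by
  obtain ⟨g, hg, hx⟩ := h
  have hsp : genericPoint X ⤳ g (IsLocalRing.closedPoint A) := genericPoint_specializes _
  rw [← Scheme.Spec_stalkClosedPointTo_fromSpecStalk g,
    ← Scheme.SpecMap_stalkSpecializes_fromSpecStalk hsp, ← Category.assoc,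
    cancel_mono, ← Spec.map_comp] at hg
  have h2 := Spec.map_injective hg
  refine ⟨(X.presheaf.germ U _ hx ≫ Scheme.stalkClosedPointTo g).hom, fun s => ?_⟩
  have h3 := congr(($h2).hom (X.presheaf.germ U _ hx s))
  refine h3.trans ?_
  exact TopCat.Presheaf.germ_stalkSpecializes_apply X.presheaf hx hsp s

variable {E : Type u} [Field E] {X : Scheme.{u}} [X.Over (Spec (.of E))] [IsIntegral X]
  {l m : ℕ}

/-- The local ring at the center maps compatibly to `Â` and to `K`, hence into `Â ∩ K = A`. The
morphism from `Spec Â` thus factors through `Spec A`. -/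
lemma FormalPrimeDivisor.hasCenterIn (φ : FormalPrimeDivisor E X l) {U : X.Opens}
    (hU : φ.center ∈ U) : X.HasCenterIn φ.ring U := by
  have hsp : genericPoint X ⤳ φ.hom (IsLocalRing.closedPoint φ.ring.Completed) :=
    genericPoint_specializes _
  have h := φ.fac
  rw [← Scheme.Spec_stalkClosedPointTo_fromSpecStalk φ.hom,
    ← Scheme.SpecMap_stalkSpecializes_fromSpecStalk hsp, ← Category.assoc, ← Category.assoc,
    cancel_mono, ← Spec.map_comp, ← Spec.map_comp] at h
  have h2 := Spec.map_injective h
  let c := (Scheme.stalkClosedPointTo φ.hom).hom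
  let p := (X.presheaf.stalkSpecializes hsp).hom
  have hc : ∀ s, algebraMap φ.ring.Completed φ.ring.CompletedFrac (c s) =
      algebraMap X.functionField φ.ring.CompletedFrac (p s) := fun s => congr(($h2).hom s)
  let ψ : X.presheaf.stalk (φ.hom (IsLocalRing.closedPoint φ.ring.Completed)) →+* φ.ring :=
    p.codRestrict φ.ring.toSubring fun s => φ.ring.mem_of_algebraMap_completedFrac_eq (hc s)
  have hψ : ∀ s, algebraMap φ.ring φ.ring.Completed (ψ s) = c s := fun s => by
    apply φ.ring.algebraMap_completed_completedFrac_injective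
    rw [hc, ← ValuationSubring.algebraMap_completedFrac_coe]
    rfl
  refine ⟨Spec.map (CommRingCat.ofHom ψ) ≫ X.fromSpecStalk _, ?_, ?_⟩
  · rw [← Spec.map_comp_assoc, ← Scheme.SpecMap_stalkSpecializes_fromSpecStalk hsp]
    rfl
  · have h3 : Spec.map (CommRingCat.ofHom (algebraMap φ.ring φ.ring.Completed)) ≫
        Spec.map (CommRingCat.ofHom ψ) ≫ X.fromSpecStalk _ = φ.hom := by
      rw [← Spec.map_comp_assoc, ← CommRingCat.ofHom_comp]
      conv_rhs => rw [← Scheme.Spec_stalkClosedPointTo_fromSpecStalk φ.hom]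
      congr 2
      exact CommRingCat.hom_ext (RingHom.ext hψ)
    -- `A → Â` is a local homomorphism, so both closed points have the same image in `X`.
    rw [← specMap_closedPoint (algebraMap φ.ring φ.ring.Completed)]
    change (Spec.map (CommRingCat.ofHom (algebraMap φ.ring φ.ring.Completed)) ≫
        Spec.map (CommRingCat.ofHom ψ) ≫ X.fromSpecStalk _) (IsLocalRing.closedPoint _) ∈ U
    rw [h3]
    exact hU

lemma HasCenterIn.exists_formalPrimeDivisor {A : DivisorialValuationRing E X.functionField l}
    {U : X.Opens} (h : X.HasCenterIn A.ring U) :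
    ∃ φ : FormalPrimeDivisor E X l, φ.toDivisorialValuationRing = A ∧ φ.center ∈ U := by
  obtain ⟨g, hg, hx⟩ := h
  refine ⟨⟨A, Spec.map (CommRingCat.ofHom (algebraMap A.ring A.ring.Completed)) ≫ g, ?_⟩, rfl, ?_⟩
  · rw [← hg, ← Spec.map_comp_assoc, ← Spec.map_comp_assoc]
    congr 2
    ext s
    exact (A.ring.algebraMap_completedFrac_coe s).symm
  · rw [← specMap_closedPoint (algebraMap A.ring A.ring.Completed)] at hx
    exact hx

/-- From here on completions no longer occur: adjointness is a condition on valuation rings of `K`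
alone. -/
lemma forall_isRegular_iff [CharZero E] (hl : Algebra.trdeg E X.functionField = l) (U : X.Opens)
    (η : RationalForm E X l m) :
    (∀ φ : FormalPrimeDivisor E X l, φ.center ∈ U → φ.IsRegular η) ↔
      ∀ A : DivisorialValuationRing E X.functionField l, X.HasCenterIn A.ring U →
        η ∈ LinearMap.range (PluriForm.linearMap E A.ring X.functionField l m) := by
  constructor
  · intro h A hA
    obtain ⟨φ, rfl, hφ⟩ := hA.exists_formalPrimeDivisor
    exact (φ.one_tmul_mem_completedForms_iff hl η).mp (h φ hφ)
  · intro h φ hφ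
    exact (φ.one_tmul_mem_completedForms_iff hl η).mpr (h _ (φ.hasCenterIn hφ))

end AlgebraicGeometry.Scheme

/-! ### Transport along isomorphisms of fields -/

lemma PluriForm.linearMap_bijective {E R S : Type u} [CommRing E] [CommRing R] [CommRing S]
    [Algebra E R] [Algebra E S] [Algebra R S] [IsScalarTower E R S] (l m : ℕ)
    (h : Function.Bijective (algebraMap R S)) :
    Function.Bijective (PluriForm.linearMap E R S l m) := by
  let e := RingEquiv.ofBijective (algebraMap R S) h
  let _ : Algebra S R := e.symm.toRingHom.toAlgebra
  have hRS : ∀ r : R, algebraMap S R (algebraMap R S r) = r := e.symm_apply_apply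
  have hSR : ∀ s : S, algebraMap R S (algebraMap S R s) = s := e.apply_symm_apply
  have : IsScalarTower E S R := IsScalarTower.of_algebraMap_eq fun x => by
    rw [IsScalarTower.algebraMap_apply E R S, hRS]
  have : IsScalarTower R S R := IsScalarTower.of_algebraMap_eq fun r => (hRS r).symm
  have : IsScalarTower S R S := IsScalarTower.of_algebraMap_eq fun s => (hSR s).symm
  refine Function.bijective_iff_has_inverse.mpr ⟨PluriForm.linearMap E S R l m, fun x => ?_,
    fun x => ?_⟩
  · rw [PluriForm.linearMap_linearMap, PluriForm.linearMap_self]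
  · rw [PluriForm.linearMap_linearMap, PluriForm.linearMap_self]

lemma Algebra.trdeg_residueField_eq_of_ringEquiv {E R S : Type u} [Field E] [CommRing R]
    [CommRing S] [IsLocalRing R] [IsLocalRing S] [Algebra E R] [Algebra E S] (e : R ≃+* S)
    (he : ∀ x : E, e (algebraMap E R x) = algebraMap E S x) :
    Algebra.trdeg E (IsLocalRing.ResidueField R) = Algebra.trdeg E (IsLocalRing.ResidueField S) :=
  (AlgEquiv.ofRingEquiv (f := IsLocalRing.ResidueField.mapEquiv e) fun x => by
    change IsLocalRing.residue S (e (algebraMap E R x)) = IsLocalRing.residue S (algebraMap E S x)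
    rw [he]).trdeg_eq

namespace DivisorialValuationRing

variable {E K K' : Type u} [Field E] [Field K] [Algebra E K] [Field K'] [Algebra E K'] {l m : ℕ}

/-- The restriction of a valuation ring along an isomorphism of fields. -/
def comapEquiv (A : ValuationSubring K') (σ : K ≃+* K') : A.comap σ.toRingHom ≃+* A where
  toFun x := ⟨σ x, x.2⟩
  invFun x := ⟨σ.symm x, by
    change σ (σ.symm x) ∈ A
    simp⟩
  left_inv x := Subtype.ext (σ.symm_apply_apply _)
  right_inv x := Subtype.ext (σ.apply_symm_apply _)
  map_mul' x y := Subtype.ext (map_mul σ _ _)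
  map_add' x y := Subtype.ext (map_add σ _ _)

/-- The restriction of a divisorial valuation ring along an isomorphism of fields. -/
def comap (A : DivisorialValuationRing E K' l) (σ : K ≃ₐ[E] K') :
    DivisorialValuationRing E K l where
  ring := A.ring.comap (σ : K ≃+* K').toRingHom
  algebraMap_mem x := by
    change σ (algebraMap E K x) ∈ A.ring
    rw [σ.commutes]
    exact A.algebraMap_mem x
  isDiscrete := IsDiscreteValuationRing.RingEquivClass.isDiscreteValuationRing
    (comapEquiv A.ring (σ : K ≃+* K')).symm
  trdeg_residueField := by
    let _ : Algebra E (A.ring.comap (σ : K ≃+* K').toRingHom) :=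
      ((algebraMap E K).codRestrict (A.ring.comap (σ : K ≃+* K').toRingHom).toSubring fun x => by
        change σ (algebraMap E K x) ∈ A.ring
        rw [σ.commutes]
        exact A.algebraMap_mem x).toAlgebra
    rw [Algebra.trdeg_residueField_eq_of_ringEquiv (comapEquiv A.ring (σ : K ≃+* K'))]
    · exact A.trdeg_residueField
    · exact fun x => Subtype.ext (σ.commutes x)

lemma ext_of_ring_eq {A B : DivisorialValuationRing E K l} (h : A.ring = B.ring) : A = B := by
  obtain ⟨A, _, _, _⟩ := A
  obtain ⟨B, _, _, _⟩ := B
  cases h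
  rfl

lemma comap_symm_comap (A : DivisorialValuationRing E K l) (σ : K ≃ₐ[E] K') :
    (A.comap σ.symm).comap σ = A := by
  have h : ((A.comap σ.symm).comap σ).ring = A.ring := by
    ext x
    change σ.symm (σ x) ∈ A.ring ↔ _
    rw [σ.symm_apply_apply]
  exact ext_of_ring_eq h

lemma linearMap_mem_range_iff [Algebra K K'] [IsScalarTower E K K'] (σ : K ≃ₐ[E] K')
    (hσ : ∀ x, σ x = algebraMap K K' x) (A : DivisorialValuationRing E K' l)
    (η : PluriForm E K l m) :
    PluriForm.linearMap E K K' l m η ∈ LinearMap.range (PluriForm.linearMap E A.ring K' l m) ↔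
      η ∈ LinearMap.range (PluriForm.linearMap E (A.comap σ).ring K l m) := by
  let e : (A.comap σ).ring ≃+* A.ring := comapEquiv A.ring (σ : K ≃+* K')
  let _ : Algebra (A.comap σ).ring A.ring := e.toRingHom.toAlgebra
  let _ : Algebra (A.comap σ).ring K' :=
    ((algebraMap K K').comp (algebraMap (A.comap σ).ring K)).toAlgebra
  have : IsScalarTower (A.comap σ).ring K K' := IsScalarTower.of_algebraMap_eq' rfl
  have : IsScalarTower (A.comap σ).ring A.ring K' :=
    IsScalarTower.of_algebraMap_eq fun x => (hσ x).symm
  have : IsScalarTower E (A.comap σ).ring A.ring :=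
    IsScalarTower.of_algebraMap_eq fun x => Subtype.ext (σ.commutes x).symm
  have : IsScalarTower E (A.comap σ).ring K' := IsScalarTower.of_algebraMap_eq fun x =>
    IsScalarTower.algebraMap_apply E K K' x
  constructor
  · rintro ⟨w, hw⟩
    obtain ⟨v, rfl⟩ := (PluriForm.linearMap_bijective (E := E) l m e.bijective).2 w
    refine ⟨v, (PluriForm.linearMap_bijective (E := E) (R := K) (S := K') l m ?_).1 ?_⟩
    · rw [show ⇑(algebraMap K K') = σ from funext fun x => (hσ x).symm]
      exact σ.bijective
    · rw [PluriForm.linearMap_linearMap, ← hw, PluriForm.linearMap_linearMap]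
  · rintro ⟨v, rfl⟩
    exact ⟨PluriForm.linearMap E (A.comap σ).ring A.ring l m v, by
      rw [PluriForm.linearMap_linearMap, PluriForm.linearMap_linearMap]⟩

end DivisorialValuationRing

/-! ### Invariance of adjoint forms under proper birational morphisms -/

namespace AlgebraicGeometry.Scheme

section Birational

variable {X Y : Scheme.{u}} [IsIntegral X] [IsIntegral Y] (π : Y ⟶ X)

/-- On the source of `e` the morphism `π` is an open immersion into `X`; open immersions preserve
generic points and stalks. -/
lemma PartialIso.apply_genericPoint {π : Y ⟶ X} (e : Y.PartialIso X)
    (he : e.iso.hom ≫ e.target.ι = e.source.ι ≫ π) :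
    π (genericPoint Y) = genericPoint X ∧ IsIso (π.stalkMap (genericPoint Y)) := by
  have hmem : genericPoint Y ∈ e.source := by
    obtain ⟨y, hy⟩ := e.dense_source.nonempty
    exact ((genericPoint_spec Y).mem_open_set_iff e.source.isOpen).mpr ⟨y, trivial, hy⟩
  have : Nonempty e.source := ⟨⟨_, hmem⟩⟩
  have : IsOpenImmersion (e.source.ι ≫ π) := he ▸ inferInstance
  have h1 := genericPoint_eq_of_isOpenImmersion e.source.ι
  have h2 := genericPoint_eq_of_isOpenImmersion (e.source.ι ≫ π)
  rw [Scheme.Hom.comp_apply] at h2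
  rw [← h1]
  refine ⟨h2, ?_⟩
  have h3 := Scheme.Hom.stalkMap_comp e.source.ι π (genericPoint e.source.toScheme)
  have h4 : IsIso ((e.source.ι ≫ π).stalkMap (genericPoint e.source.toScheme)) := inferInstance
  have : IsIso (π.stalkMap (e.source.ι (genericPoint e.source)) ≫
      e.source.ι.stalkMap (genericPoint e.source)) := h3 ▸ h4
  exact IsIso.of_isIso_comp_right _ (e.source.ι.stalkMap (genericPoint e.source))

/-- The map on function fields induced by a dominant morphism. -/
def functionFieldMap (h : π (genericPoint Y) = genericPoint X) :
    X.functionField ⟶ Y.functionField :=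
  X.presheaf.stalkSpecializes (specializes_of_eq h) ≫ π.stalkMap (genericPoint Y)

lemma functionFieldMap_germ (h : π (genericPoint Y) = genericPoint X) (U : X.Opens)
    (hU : genericPoint X ∈ U) (hV : genericPoint Y ∈ π ⁻¹ᵁ U) (f : Γ(X, U)) :
    functionFieldMap π h (X.presheaf.germ U _ hU f) =
      Y.presheaf.germ (π ⁻¹ᵁ U) _ hV (π.app U f) := by
  rw [functionFieldMap, CommRingCat.comp_apply, TopCat.Presheaf.germ_stalkSpecializes_apply]
  exact Scheme.Hom.germ_stalkMap_apply π U _ hV f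

lemma specMap_functionFieldMap_fromSpecStalk (h : π (genericPoint Y) = genericPoint X) :
    Spec.map (functionFieldMap π h) ≫ X.fromSpecStalk (genericPoint X) =
      Y.fromSpecStalk (genericPoint Y) ≫ π := by
  rw [functionFieldMap, Spec.map_comp_assoc, SpecMap_stalkSpecializes_fromSpecStalk,
    SpecMap_stalkMap_fromSpecStalk]

lemma isIso_functionFieldMap (h : π (genericPoint Y) = genericPoint X)
    [IsIso (π.stalkMap (genericPoint Y))] : IsIso (functionFieldMap π h) := by
  have : IsIso (X.presheaf.stalkSpecializes (specializes_of_eq h)) :=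
    (X.presheaf.stalkCongr (.of_eq h.symm)).isIso_hom
  rw [functionFieldMap]
  infer_instance

/-- A center on `Y` maps to one on `X`. In the other direction the valuative criterion lifts `Spec A
⟶ X` to `Y`, extending the generic point of `Y`, and the closed point of the lift lies over the old
center. -/
lemma hasCenterIn_comap_iff [IsProper π] (h : π (genericPoint Y) = genericPoint X)
    [IsIso (π.stalkMap (genericPoint Y))] (σ : X.functionField ≃+* Y.functionField)
    (hσ : ∀ x, σ x = functionFieldMap π h x) (A : ValuationSubring Y.functionField)
    (U : X.Opens) : X.HasCenterIn (A.comap σ.toRingHom) U ↔ Y.HasCenterIn A (π ⁻¹ᵁ U) := by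
  let e := DivisorialValuationRing.comapEquiv A σ
  let a : CommRingCat.of A ⟶ Y.functionField :=
    CommRingCat.ofHom (algebraMap A Y.functionField)
  let b : CommRingCat.of (A.comap σ.toRingHom) ⟶ X.functionField :=
    CommRingCat.ofHom (algebraMap (A.comap σ.toRingHom) X.functionField)
  let c : CommRingCat.of (A.comap σ.toRingHom) ≅ CommRingCat.of A := e.toCommRingCatIso
  have hsq : c.hom ≫ a = b ≫ functionFieldMap π h := by
    ext x
    exact hσ x
  have hK := specMap_functionFieldMap_fromSpecStalk π h
  have : IsIso (functionFieldMap π h) := isIso_functionFieldMap π h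
  constructor
  · rintro ⟨g, hg : Spec.map b ≫ g = _, hx⟩
    have hcomm : CommSq (Y.fromSpecStalk (genericPoint Y)) (Spec.map a) π
        (Spec.map c.hom ≫ g) := ⟨by
      rw [← Spec.map_comp_assoc, hsq, Spec.map_comp_assoc, hg, hK]⟩
    have hval : ValuativeCriterion π := by
      have h := ‹IsProper π›
      rw [IsProper.eq_valuativeCriterion] at h
      exact h.1.1.1
    obtain ⟨⟨g', h1, h2⟩⟩ := (hval.existence ⟨A, Y.functionField,
      Y.fromSpecStalk (genericPoint Y), _, hcomm⟩).exists_lift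
    have h2 : g' ≫ π = Spec.map c.hom ≫ g := h2
    refine ⟨g', h1, ?_⟩
    have h3 : Spec.map c.hom (IsLocalRing.closedPoint A) =
        IsLocalRing.closedPoint (A.comap σ.toRingHom) :=
      specMap_closedPoint (e : A.comap σ.toRingHom →+* A)
    rw [← h3] at hx
    change (g' ≫ π) (IsLocalRing.closedPoint A) ∈ U
    rw [h2]
    exact hx
  · rintro ⟨g, hg : Spec.map a ≫ g = _, hx⟩
    refine ⟨Spec.map c.inv ≫ g ≫ π, ?_, ?_⟩
    · change Spec.map b ≫ _ = _
      have hsq' : c.inv ≫ b = a ≫ inv (functionFieldMap π h) := by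
        rw [IsIso.eq_comp_inv, Category.assoc, ← hsq, Iso.inv_hom_id_assoc]
      rw [← Spec.map_comp_assoc, hsq', Spec.map_comp_assoc, reassoc_of% hg, ← hK,
        ← Spec.map_comp_assoc, IsIso.hom_inv_id, Spec.map_id]
      exact Category.id_comp _
    · have h3 : Spec.map c.inv (IsLocalRing.closedPoint (A.comap σ.toRingHom)) =
        IsLocalRing.closedPoint A := specMap_closedPoint (e.symm : A →+* (A.comap σ.toRingHom))
      rw [← h3] at hx
      exact hx

end Birational
end AlgebraicGeometry.Scheme

namespace AlgebraicGeometry.Scheme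

variable (E : Type u) [Field E] {X Y : Scheme.{u}} [X.Over (Spec (.of E))] [Y.Over (Spec (.of E))]
  (π : Y ⟶ X) (l m : ℕ)

lemma app_baseHom [π.IsOver (Spec (.of E))] (U : X.Opens) (x : E) :
    π.app U (X.baseHom E U x) = Y.baseHom E (π ⁻¹ᵁ U) x := by
  have h1 : X.baseHom E U x = X.presheaf.map (homOfLE le_top : U ⟶ ⊤).op
    ((X ↘ Spec (.of E)).appTop ((Scheme.ΓSpecIso (.of E)).inv x)) := rfl
  have h2 : Y.baseHom E (π ⁻¹ᵁ U) x = Y.presheaf.map (homOfLE le_top : π ⁻¹ᵁ U ⟶ ⊤).op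
    ((Y ↘ Spec (.of E)).appTop ((Scheme.ΓSpecIso (.of E)).inv x)) := rfl
  have h3 : (Y ↘ Spec (.of E)).appTop = (X ↘ Spec (.of E)).appTop ≫ π.appTop := by
    rw [← Scheme.Hom.comp_appTop, comp_over]
  rw [h1, h2, h3, CommRingCat.comp_apply, ← CommRingCat.comp_apply, ← CommRingCat.comp_apply,
    Scheme.Hom.naturality]
  rfl

variable [IsIntegral X] [IsIntegral Y]

variable {E l m} in
-- The equivalence `τ` is pull-back of forms along the isomorphism of function fields. It matches
-- adjointness because valuation rings correspond along that isomorphism together with their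
-- centers.
lemma exists_rationalForm_equiv [CharZero E] [IsProper π] [π.IsOver (Spec (.of E))]
    (h : π (genericPoint Y) = genericPoint X) [IsIso (π.stalkMap (genericPoint Y))]
    (hl : Algebra.trdeg E X.functionField = l) :
    Algebra.trdeg E Y.functionField = l ∧
    ∃ τ : RationalForm E X l m ≃+ RationalForm E Y l m,
      (∀ (U : X.Opens) (hU : genericPoint X ∈ U) (hV : genericPoint Y ∈ π ⁻¹ᵁ U) (f : Γ(X, U)) η,
        τ (X.presheaf.germ U _ hU f • η) = Y.presheaf.germ (π ⁻¹ᵁ U) _ hV (π.app U f) • τ η) ∧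
      ∀ (U : X.Opens) η, (∀ φ : FormalPrimeDivisor E X l, φ.center ∈ U → φ.IsRegular η) ↔
        ∀ φ : FormalPrimeDivisor E Y l, φ.center ∈ π ⁻¹ᵁ U → φ.IsRegular (τ η) := by
  let _ : Algebra X.functionField Y.functionField := (functionFieldMap π h).hom.toAlgebra
  have : IsScalarTower E X.functionField Y.functionField :=
    IsScalarTower.of_algebraMap_eq fun x => by
      refine Eq.symm ((functionFieldMap_germ π h ⊤ trivial trivial _).trans ?_)
      rw [app_baseHom]
      rfl
  have := isIso_functionFieldMap π h
  have hbij : Function.Bijective (algebraMap X.functionField Y.functionField) :=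
    ConcreteCategory.bijective_of_isIso (functionFieldMap π h)
  let σ : X.functionField ≃ₐ[E] Y.functionField :=
    AlgEquiv.ofBijective (Algebra.algHom E X.functionField Y.functionField) hbij
  have hl' : Algebra.trdeg E Y.functionField = l := σ.trdeg_eq ▸ hl
  refine ⟨hl', AddEquiv.ofBijective (PluriForm.linearMap E X.functionField Y.functionField l m)
    (PluriForm.linearMap_bijective l m hbij), fun U hU hV f η => ?_, fun U η => ?_⟩
  · rw [← functionFieldMap_germ π h U hU hV f]
    change PluriForm.linearMap E X.functionField Y.functionField l m _ = _
    rw [map_smul, ← algebraMap_smul Y.functionField]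
    rfl
  · rw [forall_isRegular_iff hl, forall_isRegular_iff hl']
    have key : ∀ A : DivisorialValuationRing E Y.functionField l,
        X.HasCenterIn (A.comap σ).ring U ↔ Y.HasCenterIn A.ring (π ⁻¹ᵁ U) := fun A =>
      hasCenterIn_comap_iff π h (σ : X.functionField ≃+* Y.functionField) (fun _ => rfl) A.ring U
    constructor
    · intro H A hA
      exact (A.linearMap_mem_range_iff σ (fun _ => rfl) η).mpr (H _ ((key A).mpr hA))
    · intro H A hA
      rw [← A.comap_symm_comap σ] at hA ⊢
      exact (DivisorialValuationRing.linearMap_mem_range_iff σ (fun _ => rfl) _ η).mp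
        (H _ ((key _).mp hA))

variable {E π l m} in
/-- A dictionary between the rational forms of `X` and `Y` that matches the adjoint forms on `U`
and on `π ⁻¹ U` gives an isomorphism of `Ω_adj` of `X` with the direct image of that of `Y`. -/
lemma nonempty_adjointSheaf_iso_pushforward
    (h : π (genericPoint Y) = genericPoint X)
    (τ : RationalForm E X l m ≃+ RationalForm E Y l m)
    (hτ : ∀ (U : X.Opens) (hU : genericPoint X ∈ U) (hV : genericPoint Y ∈ π ⁻¹ᵁ U)
        (f : Γ(X, U)) η,
        τ (X.presheaf.germ U _ hU f • η) = Y.presheaf.germ (π ⁻¹ᵁ U) _ hV (π.app U f) • τ η)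
    (hadj : ∀ (U : X.Opens) η, (∀ φ : FormalPrimeDivisor E X l, φ.center ∈ U → φ.IsRegular η) ↔
        ∀ φ : FormalPrimeDivisor E Y l, φ.center ∈ π ⁻¹ᵁ U → φ.IsRegular (τ η)) :
    Nonempty (X.adjointSheaf E l m ≅
      (Scheme.Modules.pushforward π).obj (Y.adjointSheaf E l m)) := by
  let a (U : X.Opens) : adjointSections E X l m U →+ adjointSections E Y l m (π ⁻¹ᵁ U) :=
    { toFun := fun s => ⟨fun y => τ (s.1 ⟨π y.1, y.2⟩), by
        obtain ⟨η, hs, hη⟩ := s.2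
        exact ⟨τ η, fun y => congrArg τ (hs _), (hadj U η).mp hη⟩⟩
      map_zero' := Subtype.ext <| funext fun y => map_zero τ
      map_add' := fun s t => Subtype.ext <| funext fun y => map_add τ _ _ }
  have ha (U : X.Opens) : Function.Bijective (a U) := by
    constructor
    · intro s t hst
      refine Subtype.ext <| funext fun x => ?_
      have hgen := genericPoint_mem x
      obtain ⟨η, hs, -⟩ := s.2
      obtain ⟨θ, ht, -⟩ := t.2
      -- Sections are constant functions, so it is enough to compare them at the generic point of
      -- `Y`, which lies over any nonempty `U`.
      have h1 := congrFun (congrArg Subtype.val hst)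
        ⟨genericPoint Y, show π (genericPoint Y) ∈ U from h ▸ hgen⟩
      have h2 := τ.injective h1
      rw [hs, ht] at h2
      rw [hs, ht, h2]
    · intro t
      obtain ⟨θ, ht, hθ⟩ := t.2
      refine ⟨⟨fun _ => τ.symm θ, τ.symm θ, fun _ => rfl, (hadj U _).mpr ?_⟩,
        Subtype.ext <| funext fun y => ?_⟩
      · rwa [τ.apply_symm_apply]
      · exact (τ.apply_symm_apply θ).trans (ht y).symm
  let N := (Scheme.Modules.pushforward π).obj (Y.adjointSheaf E l m)
  let b : (adjointPresheaf E X l m).presheaf ⟶ N.val.presheaf :=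
    { app := fun U => AddCommGrpCat.ofHom (a U.unop)
      naturality := fun _ _ _ => rfl }
  let f : X.adjointSheaf E l m ⟶ N := ⟨PresheafOfModules.homMk b fun U r s => by
    refine Subtype.ext <| funext fun y => ?_
    exact hτ U.unop _ _ _ _⟩
  have : IsIso f := by
    rw [Scheme.Modules.Hom.isIso_iff_isIso_app]
    intro U
    exact (ConcreteCategory.isIso_iff_bijective (f.app U)).mpr (ha U)
  exact ⟨asIso f⟩

end AlgebraicGeometry.Scheme

/-! ### Height-one localizations as divisorial valuation rings -/

namespace DivisorialValuationRing

variable {E R K : Type u} [Field E] [CommRing R] [IsDomain R] [IsDiscreteValuationRing R]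
  [Algebra E R] [Field K] [Algebra E K] [Algebra R K] [IsScalarTower E R K] [IsFractionRing R K]
  {l m : ℕ}

variable (K) in
lemma exists_ringEquiv (hl : Algebra.trdeg E (IsLocalRing.ResidueField R) + 1 = l) :
    ∃ (A : DivisorialValuationRing E K l) (e : R ≃+* A.ring),
      ∀ x, (e x : K) = algebraMap R K x := by
  let V : ValuationSubring K :=
    { (algebraMap R K).range with
      mem_or_inv_mem' := fun x => ValuationRing.isInteger_or_isInteger R x }
  let e : R ≃+* V := RingEquiv.ofBijective
    ((algebraMap R K).codRestrict V.toSubring fun x => ⟨x, rfl⟩)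
    ⟨fun x y h => IsFractionRing.injective R K (congrArg Subtype.val h), fun ⟨_, x, hx⟩ =>
      ⟨x, Subtype.ext hx⟩⟩
  have hE : ∀ x : E, algebraMap E K x ∈ V := fun x =>
    ⟨algebraMap E R x, (IsScalarTower.algebraMap_apply E R K x).symm⟩
  refine ⟨⟨V, hE, IsDiscreteValuationRing.RingEquivClass.isDiscreteValuationRing e, ?_⟩, e,
    fun _ => rfl⟩
  let _ : Algebra E V := ((algebraMap E K).codRestrict V.toSubring hE).toAlgebra
  rw [← hl, Algebra.trdeg_residueField_eq_of_ringEquiv e]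
  exact fun x => Subtype.ext (IsScalarTower.algebraMap_apply E R K x).symm

omit [IsDomain R] [IsDiscreteValuationRing R] in
lemma mem_range_linearMap_of_ringEquiv {A : DivisorialValuationRing E K l} (e : R ≃+* A.ring)
    (he : ∀ x, (e x : K) = algebraMap R K x) {η : PluriForm E K l m}
    (hη : η ∈ LinearMap.range (PluriForm.linearMap E A.ring K l m)) :
    η ∈ LinearMap.range (PluriForm.linearMap E R K l m) := by
  let _ : Algebra A.ring R := e.symm.toRingHom.toAlgebra
  have hA : ∀ x : A.ring, algebraMap R K (algebraMap A.ring R x) = x := fun x => by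
    rw [← he]
    exact congrArg Subtype.val (e.apply_symm_apply x)
  have : IsScalarTower A.ring R K := IsScalarTower.of_algebraMap_eq fun x => (hA x).symm
  have : IsScalarTower E A.ring R := IsScalarTower.of_algebraMap_eq fun x => by
    apply IsFractionRing.injective R K
    rw [hA, ← IsScalarTower.algebraMap_apply]
    rfl
  obtain ⟨w, rfl⟩ := hη
  exact ⟨PluriForm.linearMap E A.ring R l m w, PluriForm.linearMap_linearMap ..⟩

end DivisorialValuationRing

lemma IsRegularLocalRing.isDiscreteValuationRing {R : Type*} [CommRing R] [IsDomain R]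
    [IsRegularLocalRing R] (h : ringKrullDim R = 1) : IsDiscreteValuationRing R := by
  have hf : ¬ IsField R := fun hf => by
    rw [ringKrullDim_eq_zero_of_isField hf] at h
    exact zero_ne_one h
  have h1 := (IsRegularLocalRing.iff_finrank_cotangentSpace R).mp inferInstance
  rw [h] at h1
  exact ((IsDiscreteValuationRing.TFAE R hf).out 0 5).mpr (by exact_mod_cast h1)

section

variable {E B K : Type u} [Field E] [CharZero E] [CommRing B] [IsDomain B] [Algebra E B]
  [Algebra.FiniteType E B] [Field K] [Algebra E K] [Algebra B K] [IsScalarTower E B K]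
  [IsFractionRing B K] {l m : ℕ}

omit [CharZero E] in
lemma exists_trdeg_residueField_eq (hl : Algebra.trdeg E K = l) (p : Ideal B) [p.IsPrime] {n : ℕ}
    (hn : p.height = n) : ∃ r : ℕ, Algebra.trdeg E p.ResidueField = r ∧ n + r ≤ l := by
  have : IsNoetherianRing B := Algebra.FiniteType.isNoetherianRing E B
  have h1 := Algebra.height_add_trdeg_quotient_le (E := E) p hn
  have : Algebra.IsAlgebraic B K := IsLocalization.isAlgebraic _ (nonZeroDivisors B)
  rw [Algebra.trdeg_eq_of_isAlgebraic (E := E) (A := B) (C := K), hl] at h1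
  obtain ⟨r, hr⟩ := Cardinal.lt_aleph0.mp
    ((le_add_self.trans h1).trans_lt Cardinal.natCast_lt_aleph0)
  have : Algebra.IsAlgebraic (B ⧸ p) p.ResidueField :=
    IsLocalization.isAlgebraic _ (nonZeroDivisors (B ⧸ p))
  have : IsScalarTower E (B ⧸ p) p.ResidueField := IsScalarTower.of_algebraMap_eq fun x => by
    rw [IsScalarTower.algebraMap_apply E B (B ⧸ p), ← IsScalarTower.algebraMap_apply B,
      ← IsScalarTower.algebraMap_apply]
  rw [← Algebra.trdeg_eq_of_isAlgebraic (E := E) (A := B ⧸ p) (C := p.ResidueField), hr]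
  rw [hr] at h1
  exact ⟨r, rfl, by exact_mod_cast h1⟩

/-- The generators are taken from `B` itself, so that they can be spread out to a neighbourhood. The
equality `n + r = l` is what makes primes of height one divisorial. -/
lemma exists_span_range_D_localization_eq_top (hl : Algebra.trdeg E K = l) (p : Ideal B)
    [p.IsPrime] [IsRegularLocalRing (Localization.AtPrime p)] {n : ℕ} (hn : p.height = n) :
    ∃ r : ℕ, Algebra.trdeg E p.ResidueField = r ∧ n + r = l ∧ ∃ a : Fin l → B,
      Submodule.span (Localization.AtPrime p) (Set.range fun i =>
        KaehlerDifferential.D E (Localization.AtPrime p) (algebraMap B _ (a i))) = ⊤ := by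
  obtain ⟨r, hr, hle⟩ := exists_trdeg_residueField_eq hl p hn
  let R := Localization.AtPrime p
  have hdom : IsDomain R := IsLocalization.isDomain_localization p.primeCompl_le_nonZeroDivisors
  let _ : Algebra R K := (IsLocalization.lift (M := p.primeCompl) (S := R) (g := algebraMap B K)
    fun y => IsUnit.mk0 _ fun h => nonZeroDivisors.ne_zero (p.primeCompl_le_nonZeroDivisors y.2)
      (IsFractionRing.injective B K (h.trans (map_zero _).symm))).toAlgebra
  have : IsScalarTower B R K :=
    IsScalarTower.of_algebraMap_eq fun x => (IsLocalization.lift_eq _ x).symm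
  have : IsScalarTower E R K := IsScalarTower.of_algebraMap_eq fun x => by
    rw [IsScalarTower.algebraMap_apply E B R, ← IsScalarTower.algebraMap_apply B R K,
      ← IsScalarTower.algebraMap_apply]
  have : IsFractionRing R K :=
    .isFractionRing_of_isDomain_of_isLocalization p.primeCompl R K
  have : Algebra.EssFiniteType E R := .comp E B R
  have hdim : ringKrullDim R = n := by
    rw [IsLocalization.AtPrime.ringKrullDim_eq_height p R, hn]
    rfl
  obtain ⟨h1, a, ha, hspan⟩ := KaehlerDifferential.exists_span_range_D_eq_top (K := K) hdim hr hl
    hle (S := Set.range (algebraMap B R)) (by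
      have h := KaehlerDifferential.span_range_map_derivation_of_isLocalization E B R p.primeCompl
      rw [← Set.range_comp]
      simpa only [Function.comp_def, KaehlerDifferential.map_D] using h)
  choose b hb using ha
  obtain rfl : (fun i => algebraMap B R (b i)) = a := funext hb
  exact ⟨r, hr, h1, b, hspan⟩

/-- Write `η` as `f` times the generator. At a prime of height one the hypothesis applies to `B_p`
and puts `f` into `B_p`; the intersection of these rings is `B`. -/
lemma mem_range_linearMap_of_forall_divisorialValuationRing (hl : Algebra.trdeg E K = l)
    (hB : ∀ (p : Ideal B) [p.IsPrime], IsRegularLocalRing (Localization.AtPrime p))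
    {a : Fin l → B} (ha : Submodule.span B (Set.range fun i => KaehlerDifferential.D E B (a i)) = ⊤)
    {η : PluriForm E K l m}
    (hη : ∀ A : DivisorialValuationRing E K l, (∀ b : B, algebraMap B K b ∈ A.ring) →
      η ∈ LinearMap.range (PluriForm.linearMap E A.ring K l m)) :
    η ∈ LinearMap.range (PluriForm.linearMap E B K l m) := by
  have : IsNoetherianRing B := Algebra.FiniteType.isNoetherianRing E B
  have haK := KaehlerDifferential.span_range_D_comp_algebraMap_eq_top' (S := K)
    (nonZeroDivisors B) ha
  have hfr := (KaehlerDifferential.finrank_of_trdeg_eq hl).2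
  obtain ⟨f, rfl⟩ := PluriForm.exists_eq_smul_generator haK η
  refine (PluriForm.smul_generator_mem_range_iff hfr ha haK f).mpr ?_
  refine IsFractionRing.exists_algebraMap_eq_of_height_eq_one hB f fun p _ hp => ?_
  have := hB p
  let R := Localization.AtPrime p
  have hdom : IsDomain R := IsLocalization.isDomain_localization p.primeCompl_le_nonZeroDivisors
  let _ : Algebra R K := (IsLocalization.lift (M := p.primeCompl) (S := R) (g := algebraMap B K)
    fun y => IsUnit.mk0 _ fun h => nonZeroDivisors.ne_zero (p.primeCompl_le_nonZeroDivisors y.2)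
      (IsFractionRing.injective B K (h.trans (map_zero _).symm))).toAlgebra
  have : IsScalarTower B R K :=
    IsScalarTower.of_algebraMap_eq fun x => (IsLocalization.lift_eq _ x).symm
  have : IsScalarTower E R K := IsScalarTower.of_algebraMap_eq fun x => by
    rw [IsScalarTower.algebraMap_apply E B R, ← IsScalarTower.algebraMap_apply B R K,
      ← IsScalarTower.algebraMap_apply]
  have : IsFractionRing R K :=
    .isFractionRing_of_isDomain_of_isLocalization p.primeCompl R K
  have hdim : ringKrullDim R = 1 := by
    rw [IsLocalization.AtPrime.ringKrullDim_eq_height p R, hp]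
    rfl
  have : IsDiscreteValuationRing R := IsRegularLocalRing.isDiscreteValuationRing hdim
  obtain ⟨r, hr, hrl, -⟩ := exists_span_range_D_localization_eq_top hl p (n := 1)
    (by simpa using hp)
  -- With height one, `1 + r = l` is exactly the residue field condition on a divisorial valuation
  -- ring.
  obtain ⟨A, e, he⟩ := DivisorialValuationRing.exists_ringEquiv (E := E) (R := R) K (l := l) (by
    rw [← hrl, Nat.cast_add, add_comm, ← hr]
    rfl)
  have h1 := DivisorialValuationRing.mem_range_linearMap_of_ringEquiv e he (hη A fun b => by
    rw [IsScalarTower.algebraMap_apply B R K, ← he]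
    exact (e _).2)
  have haR := KaehlerDifferential.span_range_D_comp_algebraMap_eq_top' (S := R) p.primeCompl ha
  simp only [IsScalarTower.algebraMap_apply B R K] at h1 haK
  obtain ⟨c, hc⟩ := (PluriForm.smul_generator_mem_range_iff hfr haR haK f).mp h1
  obtain ⟨x, s, rfl⟩ := IsLocalization.exists_mk'_eq p.primeCompl c
  refine ⟨x, s, s.2, ?_⟩
  have hs : algebraMap B K s ≠ 0 := fun h =>
    nonZeroDivisors.ne_zero (p.primeCompl_le_nonZeroDivisors s.2)
      (IsFractionRing.injective B K (h.trans (map_zero _).symm))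
  rw [eq_div_iff hs, ← hc, IsScalarTower.algebraMap_apply B R K, ← map_mul,
    IsLocalization.mk'_spec, ← IsScalarTower.algebraMap_apply B R K]

end

/-! ### Affine neighbourhoods with generating differentials -/

namespace AlgebraicGeometry.Scheme

lemma isRegularLocalRing_localization_of_isAffineOpen {X : Scheme.{u}} {U : X.Opens}
    (hU : IsAffineOpen U) (hX : ∀ x : X, IsRegularLocalRing (X.presheaf.stalk x))
    (p : Ideal Γ(X, U)) [hp : p.IsPrime] : IsRegularLocalRing (Localization.AtPrime p) := by
  have hmem : hU.fromSpec (⟨p, hp⟩ : PrimeSpectrum Γ(X, U)) ∈ U :=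
    hU.range_fromSpec.le ⟨_, rfl⟩
  let _ := TopCat.Presheaf.algebra_section_stalk X.presheaf ⟨_, hmem⟩
  have : IsLocalization.AtPrime
      (X.presheaf.stalk (hU.fromSpec (⟨p, hp⟩ : PrimeSpectrum Γ(X, U)))) p :=
    hU.isLocalization_stalk' ⟨p, hp⟩ hmem
  have := hX (hU.fromSpec (⟨p, hp⟩ : PrimeSpectrum Γ(X, U)))
  exact .of_ringEquiv (IsLocalization.algEquiv p.primeCompl
    (X.presheaf.stalk (hU.fromSpec (⟨p, hp⟩ : PrimeSpectrum Γ(X, U))))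
    (Localization.AtPrime p)).toRingEquiv

lemma mem_basicOpen_iff_notMem_primeIdealOf {X : Scheme.{u}} {U : X.Opens} (hU : IsAffineOpen U)
    (x : U) (t : Γ(X, U)) : (x : X) ∈ X.basicOpen t ↔ t ∉ (hU.primeIdealOf x).asIdeal := by
  have := hU.isLocalization_stalk x
  exact (Scheme.mem_basicOpen X t x x.2).trans
    (IsLocalization.AtPrime.isUnit_to_map_iff (X.presheaf.stalk (x : X)) _ t)

/-- A valuation ring that contains the sections over an affine open `U` has a center in `U`. -/
lemma hasCenterIn_of_isAffineOpen {X : Scheme.{u}} [IsIntegral X] {U : X.Opens}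
    (hU : IsAffineOpen U) [Nonempty U] {A : ValuationSubring X.functionField}
    (hA : ∀ f : Γ(X, U), algebraMap Γ(X, U) X.functionField f ∈ A) : X.HasCenterIn A U := by
  let ψ : Γ(X, U) →+* A := (algebraMap Γ(X, U) X.functionField).codRestrict A.toSubring hA
  let a : CommRingCat.of A ⟶ X.functionField := CommRingCat.ofHom (algebraMap A X.functionField)
  let b : Γ(X, U) ⟶ CommRingCat.of A := CommRingCat.ofHom ψ
  have hgen : genericPoint X ∈ U := genericPoint_mem (Classical.arbitrary U)
  refine ⟨Spec.map b ≫ hU.fromSpec, ?_, ?_⟩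
  · change Spec.map a ≫ Spec.map b ≫ hU.fromSpec = _
    rw [← Spec.map_comp_assoc, ← hU.fromSpecStalk_eq_fromSpecStalk hgen, IsAffineOpen.fromSpecStalk]
    rfl
  · exact hU.range_fromSpec.le ⟨_, rfl⟩

variable (E : Type u) [Field E] {X : Scheme.{u}} [X.Over (Spec (.of E))]

/-- Generators of the differentials of the local ring at `x` still generate on a basic open
neighbourhood, after inverting one `t` that does not vanish at `x`. -/
lemma exists_isAffineOpen_span_range_D_eq_top [CharZero E] [IsIntegral X]
    [LocallyOfFiniteType (X ↘ Spec (.of E))] {l : ℕ} (hl : Algebra.trdeg E X.functionField = l)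
    (hX : ∀ x : X, IsRegularLocalRing (X.presheaf.stalk x)) {U : X.Opens} {x : X} (hx : x ∈ U) :
    ∃ V : X.Opens, V ≤ U ∧ x ∈ V ∧ IsAffineOpen V ∧ ∃ a : Fin l → Γ(X, V),
      Submodule.span Γ(X, V) (Set.range fun i => KaehlerDifferential.D E Γ(X, V) (a i)) = ⊤ := by
  obtain ⟨_, ⟨W, hW, rfl⟩, hxW, hWU⟩ :=
    X.isBasis_affineOpens.exists_subset_of_mem_open hx U.isOpen
  have : Nonempty W := ⟨⟨x, hxW⟩⟩
  have := finiteType_of_isAffineOpen E X hW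
  have := functionField_isFractionRing_of_isAffineOpen X W hW
  have : IsNoetherianRing Γ(X, W) := Algebra.FiniteType.isNoetherianRing E _
  let p := (hW.primeIdealOf ⟨x, hxW⟩).asIdeal
  have hp : p.IsPrime := (hW.primeIdealOf ⟨x, hxW⟩).2
  have := isRegularLocalRing_localization_of_isAffineOpen hW hX p
  obtain ⟨n, hn⟩ := ENat.ne_top_iff_exists.mp (Ideal.height_ne_top hp.ne_top)
  obtain ⟨-, -, -, a, ha⟩ := exists_span_range_D_localization_eq_top hl p hn.symm
  obtain ⟨t, ht, hspan⟩ := KaehlerDifferential.exists_smul_D_mem_span p.primeCompl a ha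
  have := hW.isLocalization_basicOpen t
  have htower : IsScalarTower E Γ(X, W) Γ(X, X.basicOpen t) :=
    IsScalarTower.of_algebraMap_eq fun e => (map_baseHom E X (homOfLE (X.basicOpen_le t)) e).symm
  refine ⟨X.basicOpen t, (X.basicOpen_le t).trans hWU, ?_, hW.basicOpen t, _,
    KaehlerDifferential.span_range_D_comp_algebraMap_eq_top (Submonoid.powers t) t
      (IsLocalization.Away.algebraMap_isUnit t) hspan⟩
  exact (mem_basicOpen_iff_notMem_primeIdealOf hW ⟨x, hxW⟩ t).mpr ht

end AlgebraicGeometry.Scheme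

/-! ### Adjoint forms on a regular scheme -/

namespace AlgebraicGeometry.Scheme

variable {E : Type u} [Field E] [CharZero E] (X : Scheme.{u}) [X.Over (Spec (.of E))]
  [IsIntegral X] {l : ℕ} (m : ℕ) (hl : Algebra.trdeg E X.functionField = l)

include hl in
-- A valuation ring with a center in `U` contains the sections over `U`, so a form on `U` induces a
-- form of the valuation ring.
lemma isRegular_linearMap (U : X.Opens) [Nonempty U] (s : PluriForm E Γ(X, U) l m)
    (φ : FormalPrimeDivisor E X l) (hφ : φ.center ∈ U) :
    φ.IsRegular (PluriForm.linearMap E Γ(X, U) X.functionField l m s) := by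
  refine (forall_isRegular_iff hl U _).mpr (fun A hA => ?_) φ hφ
  obtain ⟨ψ, hψ⟩ := exists_ringHom_of_hasCenterIn hA
  let _ : Algebra Γ(X, U) A.ring := ψ.toAlgebra
  have : IsScalarTower Γ(X, U) A.ring X.functionField :=
    IsScalarTower.of_algebraMap_eq fun x => (hψ x).symm
  have : IsScalarTower E Γ(X, U) A.ring := IsScalarTower.of_algebraMap_eq fun x =>
    Subtype.ext ((IsScalarTower.algebraMap_apply E Γ(X, U) X.functionField x).trans (hψ _).symm)
  exact ⟨PluriForm.linearMap E Γ(X, U) A.ring l m s, PluriForm.linearMap_linearMap ..⟩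

/-- The rational form, at a point of `U`, of a form on `U`. -/
def toRationalForm {E : Type u} [Field E] {X : Scheme.{u}} [X.Over (Spec (.of E))] [IsIntegral X]
    {l m : ℕ} {U : X.Opens} (x : U) : PluriForm E Γ(X, U) l m →+ RationalForm E X l m :=
  haveI : Nonempty U := ⟨x⟩
  (PluriForm.linearMap E Γ(X, U) X.functionField l m).toAddMonoidHom

lemma toRationalForm_smul {E : Type u} [Field E] {X : Scheme.{u}} [X.Over (Spec (.of E))]
    [IsIntegral X] {l m : ℕ} {U : X.Opens} (x : U) (r : Γ(X, U)) (s : PluriForm E Γ(X, U) l m) :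
    toRationalForm x (r • s) =
      X.presheaf.germ U _ (genericPoint_mem x) r • toRationalForm (E := E) x s := by
  have : Nonempty U := ⟨x⟩
  exact (map_smul (PluriForm.linearMap E Γ(X, U) X.functionField l m) r s).trans
    (algebraMap_smul X.functionField r _).symm

lemma linearMap_restrictForms {E : Type u} [Field E] {X : Scheme.{u}} [X.Over (Spec (.of E))]
    [IsIntegral X] {l m : ℕ} {U V : X.Opens} [Nonempty U] [Nonempty V] (i : U ⟶ V)
    (s : PluriForm E Γ(X, V) l m) :
    PluriForm.linearMap E Γ(X, U) X.functionField l m (restrictForms E X l m i s) =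
      PluriForm.linearMap E Γ(X, V) X.functionField l m s := by
  let _ : Algebra Γ(X, V) Γ(X, U) := (X.presheaf.map i.op).hom.toAlgebra
  have : IsScalarTower E Γ(X, V) Γ(X, U) :=
    IsScalarTower.of_algebraMap_eq fun e => (map_baseHom E X i e).symm
  have : IsScalarTower Γ(X, V) Γ(X, U) X.functionField :=
    IsScalarTower.of_algebraMap_eq fun f =>
      (TopCat.Presheaf.germ_res_apply X.presheaf i (genericPoint X) _ f).symm
  exact PluriForm.linearMap_linearMap ..

/-- The map from the presheaf of forms to the adjoint forms that sends a form to its germ at the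
generic point. -/
def formsToAdjoint : formsAbPresheaf E X l m ⟶ adjointAbPresheaf E X l m where
  app U := AddCommGrpCat.ofHom
    { toFun := fun (s : PluriForm E Γ(X, U.unop) l m) =>
        (⟨fun x => toRationalForm (E := E) x s, by
          by_cases h : Nonempty U.unop
          · exact ⟨PluriForm.linearMap E Γ(X, U.unop) X.functionField l m s, fun _ => rfl,
              isRegular_linearMap X m hl U.unop s⟩
          · exact ⟨0, fun x => (h ⟨x⟩).elim, fun φ _ => φ.isRegular_zero⟩⟩ :
          adjointSections E X l m U.unop)
      map_zero' := Subtype.ext <| funext fun x => map_zero (toRationalForm (E := E) x)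
      map_add' := fun s t => Subtype.ext <| funext fun x =>
        map_add (toRationalForm (E := E) x) s t }
  naturality U V i := by
    ext s
    refine Subtype.ext <| funext fun (x : V.unop) => ?_
    have : Nonempty V.unop := ⟨x⟩
    have : Nonempty U.unop := ⟨x.1, i.unop.le x.2⟩
    exact linearMap_restrictForms i.unop s

/-- On a small affine `V` the forms are generated by one element with nonzero image at the generic
point, so a form on `V` is determined by its rational form. -/
lemma formsToAdjoint_isLocallyInjective [LocallyOfFiniteType (X ↘ Spec (.of E))]
    (hX : ∀ x : X, IsRegularLocalRing (X.presheaf.stalk x)) :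
    Presheaf.IsLocallyInjective (Opens.grothendieckTopology X) (formsToAdjoint X m hl) where
  equalizerSieve_mem {U} s t h := by
    intro x hx
    obtain ⟨V, hVU, hxV, hV, a, ha⟩ := exists_isAffineOpen_span_range_D_eq_top E hl hX hx
    refine ⟨V, homOfLE hVU, ?_, hxV⟩
    have : Nonempty V := ⟨x, hxV⟩
    have : Nonempty U.unop := ⟨x, hx⟩
    have := functionField_isFractionRing_of_isAffineOpen X V hV
    have haK := KaehlerDifferential.span_range_D_comp_algebraMap_eq_top' (S := X.functionField)
      (nonZeroDivisors Γ(X, V)) ha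
    refine PluriForm.linearMap_injective (KaehlerDifferential.finrank_of_trdeg_eq hl).2 ha haK ?_
    have h1 : PluriForm.linearMap E Γ(X, U.unop) X.functionField l m s =
      PluriForm.linearMap E Γ(X, U.unop) X.functionField l m t :=
      congrFun (congrArg Subtype.val h) ⟨x, hx⟩
    exact (linearMap_restrictForms (homOfLE hVU) s).trans
      (h1.trans (linearMap_restrictForms (homOfLE hVU) t).symm)

/-- A valuation ring containing the sections over a small affine `V` has its center in `V`, so an
adjoint form satisfies the valuative condition there and comes from a form on `V`. -/
lemma formsToAdjoint_isLocallySurjective [LocallyOfFiniteType (X ↘ Spec (.of E))]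
    (hX : ∀ x : X, IsRegularLocalRing (X.presheaf.stalk x)) :
    Presheaf.IsLocallySurjective (Opens.grothendieckTopology X) (formsToAdjoint X m hl) where
  imageSieve_mem {U} s := by
    intro x hx
    obtain ⟨V, hVU, hxV, hV, a, ha⟩ := exists_isAffineOpen_span_range_D_eq_top E hl hX hx
    refine ⟨V, homOfLE hVU, ?_, hxV⟩
    have : Nonempty V := ⟨x, hxV⟩
    have := functionField_isFractionRing_of_isAffineOpen X V hV
    have := finiteType_of_isAffineOpen E X hV
    obtain ⟨η, hs, hη⟩ : ∃ η : RationalForm E X l m, (∀ x, s.1 x = η) ∧ _ := s.2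
    obtain ⟨w, hw⟩ := mem_range_linearMap_of_forall_divisorialValuationRing hl
      (fun p _ => isRegularLocalRing_localization_of_isAffineOpen hV hX p) ha (η := η) fun A hA =>
        (forall_isRegular_iff hl V η).mp (fun φ hφ => hη φ (hVU hφ)) A
          (hasCenterIn_of_isAffineOpen hV hA)
    exact ⟨w, Subtype.ext <| funext fun y => hw.trans (hs _).symm⟩

include hl in
/-- On a regular scheme the adjoint forms are the regular forms. -/
lemma nonempty_formsSheaf_iso_adjointSheaf [LocallyOfFiniteType (X ↘ Spec (.of E))]
    (hX : ∀ x : X, IsRegularLocalRing (X.presheaf.stalk x)) :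
    Nonempty (X.formsSheaf E l m ≅ X.adjointSheaf E l m) := by
  let f : (formsPresheaf E X l m).presheaf ⟶ (X.adjointSheaf E l m).val.presheaf :=
    formsToAdjoint X m hl
  have : Presheaf.IsLocallyInjective (Opens.grothendieckTopology X) f :=
    formsToAdjoint_isLocallyInjective X m hl hX
  have : Presheaf.IsLocallySurjective (Opens.grothendieckTopology X) f :=
    formsToAdjoint_isLocallySurjective X m hl hX
  exact PresheafOfModules.nonempty_sheafification_iso (formsPresheaf E X l m)
    (X.adjointSheaf E l m) f fun U r s =>
      Subtype.ext <| funext fun (x : U.unop) => toRationalForm_smul x r s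

end AlgebraicGeometry.Scheme

end

/-! ### The theorem -/

theorem mainTheorem3 (E : Type u) [Field E] [CharZero E]
    (X : Scheme.{u}) [X.Over (Spec (.of E))] [AlgebraicGeometry.IsIntegral X]
    [IsSeparated (X ↘ Spec (.of E))] [LocallyOfFiniteType (X ↘ Spec (.of E))]
    [QuasiCompact (X ↘ Spec (.of E))]
    (l : ℕ) (hl : topologicalKrullDim X = l) (m : ℕ) :
    (∀ (Y : Scheme.{u}) [Y.Over (Spec (.of E))] [AlgebraicGeometry.IsIntegral Y]
      (π : Y ⟶ X) [π.IsOver (Spec (.of E))], Scheme.IsDesingularization π →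
        Nonempty (X.adjointSheaf E l m ≅
          (Scheme.Modules.pushforward π).obj (Y.formsSheaf E l m))) ∧
    (∀ (Y Y' : Scheme.{u}) [Y.Over (Spec (.of E))] [Y'.Over (Spec (.of E))]
      [AlgebraicGeometry.IsIntegral Y] [AlgebraicGeometry.IsIntegral Y']
      (π : Y ⟶ X) (π' : Y' ⟶ X) [π.IsOver (Spec (.of E))] [π'.IsOver (Spec (.of E))],
      Scheme.IsDesingularization π → Scheme.IsDesingularization π' →
        Nonempty ((Scheme.Modules.pushforward π).obj (Y.formsSheaf E l m) ≅
          (Scheme.Modules.pushforward π').obj (Y'.formsSheaf E l m))) := by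
  have key : ∀ (Y : Scheme.{u}) [Y.Over (Spec (.of E))] [AlgebraicGeometry.IsIntegral Y]
      (π : Y ⟶ X) [π.IsOver (Spec (.of E))], Scheme.IsDesingularization π →
        Nonempty (X.adjointSheaf E l m ≅
          (Scheme.Modules.pushforward π).obj (Y.formsSheaf E l m)) := by
    intro Y _ _ π _ hπ
    have := hπ.isProper
    have : LocallyOfFiniteType (Y ↘ Spec (.of E)) := by
      rw [← comp_over π (Spec (.of E))]
      infer_instance
    obtain ⟨e, he⟩ := hπ.birational
    obtain ⟨h, _⟩ := e.apply_genericPoint he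
    -- The dimension of `Y` is not needed: `l` reaches `Y` as the transcendence degree of the common
    -- function field.
    obtain ⟨hl', τ, hτ, hadj⟩ := Scheme.exists_rationalForm_equiv (E := E) (m := m) π h
      (Scheme.trdeg_functionField E X hl)
    obtain ⟨i⟩ := Scheme.nonempty_adjointSheaf_iso_pushforward h τ hτ hadj
    obtain ⟨j⟩ := Scheme.nonempty_formsSheaf_iso_adjointSheaf Y m hl' hπ.regular
    exact ⟨i ≪≫ (Scheme.Modules.pushforward π).mapIso j.symm⟩
  refine ⟨key, ?_⟩
  intro Y Y' _ _ _ _ π π' _ _ hπ hπ'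
  obtain ⟨i⟩ := key Y π hπ
  obtain ⟨j⟩ := key Y' π' hπ'
  exact ⟨i.symm ≪≫ j⟩
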